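/- **Setting.** Let $A\in\mathbb R^{m\times n}$, $b\in\mathbb R^m$, $c\in\mathbb R^n$, and consider $\min\{c^\top x: Ax=b,\ x\ge 0\}$ with dual $\max\{b^\top y: A^\top y\le c\}$. Let $\|\cdot\|$ and $\operatorname{Dist}$ be the Euclidean norm and distance, $q:=A^\top(AA^\top)^\dagger b$, $V_p:=\{x:Ax=b\}$, $V_d:=c+\operatorname{Im}(A^\top)$, $\mathcal F_p:=V_p\cap\mathbb R^n_+$, $\mathcal F_d:=V_d\cap\mathbb R^n_+$, $\mathcal X^\star:=\arg\min_{x\in\mathcal F_p}c^\top x$ and $\mathcal S^\star:=\arg\max_{s\in\mathcal F_d}q^\top(c-s)$. Let $\lambda_{\max},\lambda_{\min}$ be the largest and smallest nonzero singular values of $A$, and $\kappa:=\lambda_{\max}/\lambda_{\min}$. Put $\mathcal E_d(x,s):=\max\{\operatorname{Dist}(x,\mathcal X^\star),\operatorname{Dist}(s,\mathcal S^\star)\}$. **Condition measures.** For $x\in V_p$ let $\theta_p(x):=\operatorname{Dist}(x,\mathcal F_p)/\operatorname{Dist}(x,\mathbb R^n_+)$ if $x\notin\mathcal F_p$ and $\theta_p(x):=1$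 otherwise, and $$\theta_p^\star:=\lim_{\delta\downarrow0}\ \sup_{x\in V_p,\ \operatorname{Dist}(x,\mathcal X^\star)\le\delta}\theta_p(x),\qquad \mu_p:=\inf_{x\in\mathcal F_p\setminus\mathcal X^\star}\frac{\operatorname{Dist}(x,V_p\cap H_p^\star)}{\operatorname{Dist}(x,\mathcal X^\star)},$$ where $H_p^\star:=\{x\in\mathbb R^n: c^\top x=c^\top x^\star\}$ for $x^\star\in\mathcal X^\star$. Define $\theta_d^\star,\mu_d$ in the same way from $V_d,\mathcal F_d,\mathcal S^\star$ and $H_d^\star:=\{s\in\mathbb R^n:q^\top(c-s)=q^\top(c-s^\star)\}$ for $s^\star\in\mathcal S^\star$. **Algorithm.** Let $L(x,y):=c^\top x+b^\top y-x^\top A^\top y$. For step-sizes $\tau,\sigma>0$, one PDHG step maps $z=(x,y)$ to $(x^+,y^+)$ with $x^+:=P_{\mathbb R^n_+}(x-\tau(c-A^\top y))$ and $y^+:=y+\sigma(b-A(2x^+-x))$. Let $\|(x,y)\|_M:=\big(\tfrac1\tau\|x\|^2+2x^\top A^\top y+\tfrac1\sigma\|y\|^2\big)^{1/2}$ and, for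 $r>0$ and $z=(x,y)$ with $x\ge0$, $$\rho(r;z):=\frac1r\max\big\{L(x,\hat y)-L(\hat x,y):\ \hat z=(\hat x,\hat y),\ \hat x\ge0,\ \|\hat z-z\|_M\le r\big\}.$$ rPDHG starts from $z^{0,0}$. In outer loop $n$ it computes the PDHG iterates $z^{n,1},z^{n,2},\dots$ from $z^{n,0}$ and the averages $\bar z^{n,k}:=\frac1k\sum_{i=1}^kz^{n,i}$. At the first $k\ge1$ at which the $\beta$-restart condition holds, it sets $z^{n+1,0}:=\bar z^{n,k}$ and begins outer loop $n+1$. The $\beta$-restart condition holds for $n=0$ exactly when $k=1$, and for $n\ge1$ exactly when $$\rho(\|\bar z^{n,k}-z^{n,0}\|_M;\bar z^{n,k})\le\beta\,\rho(\|z^{n,0}-z^{n-1,0}\|_M;z^{n,0}).$$ Write $z^{n,0}=(x^{n,0},y^{n,0})$ and $s^{n,0}:=c-A^\top y^{n,0}$. **Theorem 3.1.** Suppose that $Ac=0$, that the LP has an optimal solution, and that there are non-optimal feasible points in the primal and in the dual, i.e. $\mathcal F_p\setminus\mathcal X^\star\ne\emptyset$ and $\mathcal F_d\setminus\mathcal S^\star\neq\emptyset$.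 Run rPDHG from $z^{0,0}=(0,0)$ with $\beta=1/e$, $$\tau=\frac{\|q\|}{2\kappa\|c\|},\qquad \sigma=\frac{\|c\|}{2\|q\|\lambda_{\max}\lambda_{\min}}.$$ Let $0<\varepsilon\le\mathcal E_d(x^{0,0},s^{0,0})$. Then rPDHG reaches an outer iterate with $\mathcal E_d(x^{n,0},s^{n,0})\le\varepsilon$, and the total number $T$ of PDHG steps performed when the first such outer iterate is obtained satisfies $$T\le 5e\,\mathcal N\ln\!\Big(8e\,\mathcal N\,\frac{\mathcal E_d(x^{0,0},s^{0,0})}{\varepsilon}\Big(1+\kappa\frac{\|c\|}{\|q\|}\Big)\Big(1+\frac{\|q\|}{\|c\|}\Big)\Big)+1,$$ $$\mathcal N:=8.5\,\kappa\Big(\frac1{\mu_p}+\frac1{\mu_d}\Big)\Big(\theta_p^\star+\theta_d^\star+\frac{\operatorname{Dist}(0,\mathcal X^\star)}{\operatorname{Dist}(0,V_p)}+\frac{\operatorname{Dist}(c,\mathcal S^\star)}{\operatorname{Dist}(0,V_d)}\Big).$$ -/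

import Mathlib

open scoped Matrix

noncomputable section

/-- Moore-Penrose inverse of a real symmetric matrix: in an orthonormal eigenbasis, nonzero
eigenvalues are inverted and zero eigenvalues are kept (`0⁻¹ = 0`). -/
def symPinv {m : ℕ} {B : Matrix (Fin m) (Fin m) ℝ} (hB : B.IsHermitian) :
    Matrix (Fin m) (Fin m) ℝ :=
  hB.cfc (fun t => t⁻¹)

/-- The four Penrose identities, which characterize the Moore-Penrose inverse. -/
theorem symPinv_penrose {m : ℕ} {B : Matrix (Fin m) (Fin m) ℝ} (hB : B.IsHermitian) :
    B * symPinv hB * B = B ∧ symPinv hB * B * symPinv hB = symPinv hB ∧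
      (B * symPinv hB)ᵀ = B * symPinv hB ∧ (symPinv hB * B)ᵀ = symPinv hB * B := by
  have hsa : IsSelfAdjoint B := hB
  have hc : ∀ f : ℝ → ℝ, ContinuousOn f (spectrum ℝ B) := fun f =>
    (Matrix.finite_real_spectrum (A := B)).continuousOn f
  have hP : symPinv hB = cfc (fun t : ℝ => t⁻¹) B := (hB.cfc_eq _).symm
  have hid : cfc (fun t : ℝ => t) B = B := cfc_id' ℝ B
  have h1 : B * symPinv hB = cfc (fun t : ℝ => t * t⁻¹) B := by
    rw [cfc_mul (fun t : ℝ => t) (fun t : ℝ => t⁻¹) B (hc _) (hc _), hid, hP]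
  have h2 : symPinv hB * B = cfc (fun t : ℝ => t⁻¹ * t) B := by
    rw [cfc_mul (fun t : ℝ => t⁻¹) (fun t : ℝ => t) B (hc _) (hc _), hid, hP]
  have htr : ∀ f : ℝ → ℝ, (cfc f B)ᵀ = cfc f B := fun f => by
    have h : IsSelfAdjoint (cfc f B) := cfc_predicate f B
    have h' : (cfc f B)ᴴ = cfc f B := h
    rwa [Matrix.conjTranspose_eq_transpose_of_trivial] at h'
  refine ⟨?_, ?_, ?_, ?_⟩
  · rw [h1]
    nth_rewrite 2 [← hid]
    rw [← cfc_mul _ _ B (hc _) (hc _)]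
    simp only [mul_inv_mul_cancel]
    exact hid
  · rw [h2, hP, ← cfc_mul _ _ B (hc _) (hc _)]
    congr 1
    funext t
    by_cases ht : t = 0 <;> simp [ht]
  · rw [h1, htr]
  · rw [h2, htr]

/-- Data `(A, b, c)` of the linear program `min cᵀx  s.t.  A x = b, x ≥ 0`, with dual
`max bᵀy  s.t.  Aᵀy ≤ c`. -/
structure LPData (m n : ℕ) where
  A : Matrix (Fin m) (Fin n) ℝ
  b : EuclideanSpace ℝ (Fin m)
  c : EuclideanSpace ℝ (Fin n)

/-- The nonnegative orthant. -/
def orthant (n : ℕ) : Set (EuclideanSpace ℝ (Fin n)) := {x | ∀ i, 0 ≤ x i}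

/-- Euclidean projection onto the nonnegative orthant (componentwise positive part). -/
def projOrthant {n : ℕ} (x : EuclideanSpace ℝ (Fin n)) : EuclideanSpace ℝ (Fin n) :=
  WithLp.toLp 2 (fun i => max (x i) 0)

/-- Error ratio at `x ∈ V` of `F = V ∩ ℝⁿ₊`; equal to `1` on `F`. -/
def errorRatio {n : ℕ} (V : Set (EuclideanSpace ℝ (Fin n))) (x : EuclideanSpace ℝ (Fin n)) : ℝ :=
  open Classical in
  if x ∈ V ∩ orthant n then 1
  else Metric.infDist x (V ∩ orthant n) / Metric.infDist x (orthant n)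

/-- Limiting error ratio: the limit, as `ε ↓ 0`, of the supremum of the error ratio over the points
of `V` within distance `ε` of the optimal set `S`. -/
def limitingER {n : ℕ} (V S : Set (EuclideanSpace ℝ (Fin n))) : ℝ :=
  Filter.limUnder (nhdsWithin (0 : ℝ) (Set.Ioi 0))
    (fun ε => sSup (errorRatio V '' {x | x ∈ V ∧ Metric.infDist x S ≤ ε}))

/-- LP sharpness for the affine set `V`, optimal objective hyperplane `H` and optimal set `S`. -/
def lpSharpness {n : ℕ} (V H S : Set (EuclideanSpace ℝ (Fin n))) : ℝ :=
  sInf ((fun x => Metric.infDist x (V ∩ H) / Metric.infDist x S) '' ((V ∩ orthant n) \ S))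

namespace LPData

variable {m n : ℕ} (P : LPData m n)

/-- `x ↦ A x`. -/
def mulA (x : EuclideanSpace ℝ (Fin n)) : EuclideanSpace ℝ (Fin m) :=
  Matrix.toEuclideanLin P.A x

/-- `y ↦ Aᵀ y`. -/
def mulAT (y : EuclideanSpace ℝ (Fin m)) : EuclideanSpace ℝ (Fin n) :=
  Matrix.toEuclideanLin P.Aᵀ y

/-- `q = Aᵀ (A Aᵀ)† b`. -/
def q : EuclideanSpace ℝ (Fin n) :=
  P.mulAT (Matrix.toEuclideanLin
    (symPinv (by simpa using Matrix.isHermitian_mul_conjTranspose_self P.A :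
      (P.A * P.Aᵀ).IsHermitian)) P.b)

/-- `V_p = {x : A x = b}`. -/
def Vp : Set (EuclideanSpace ℝ (Fin n)) := {x | P.mulA x = P.b}

/-- `V_d = c + Im Aᵀ`. -/
def Vd : Set (EuclideanSpace ℝ (Fin n)) := {s | ∃ y, s = P.c + P.mulAT y}

/-- Primal feasible set. -/
def Fp : Set (EuclideanSpace ℝ (Fin n)) := P.Vp ∩ orthant n

/-- Dual feasible set, in the slack variable. -/
def Fd : Set (EuclideanSpace ℝ (Fin n)) := P.Vd ∩ orthant n

/-- Primal optimal set: minimizers of `cᵀx` over `F_p`. -/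
def Xopt : Set (EuclideanSpace ℝ (Fin n)) :=
  {x | x ∈ P.Fp ∧ IsMinOn (fun x' => inner ℝ P.c x') P.Fp x}

/-- Dual optimal set in the slack variable: maximizers of `qᵀ(c - s)` over `F_d`. -/
def Sopt : Set (EuclideanSpace ℝ (Fin n)) :=
  {s | s ∈ P.Fd ∧ IsMaxOn (fun s' => inner ℝ P.q (P.c - s')) P.Fd s}

/-- Primal optimal objective hyperplane. -/
def Hp : Set (EuclideanSpace ℝ (Fin n)) :=
  {x | ∃ x' ∈ P.Xopt, inner ℝ P.c x = inner ℝ P.c x'}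

/-- Dual optimal objective hyperplane. -/
def Hd : Set (EuclideanSpace ℝ (Fin n)) :=
  {s | ∃ s' ∈ P.Sopt, inner ℝ P.q (P.c - s) = inner ℝ P.q (P.c - s')}

/-- Primal limiting error ratio. -/
def thetaP : ℝ := limitingER P.Vp P.Xopt

/-- Dual limiting error ratio. -/
def thetaD : ℝ := limitingER P.Vd P.Sopt

/-- Primal LP sharpness. -/
def muP : ℝ := lpSharpness P.Vp P.Hp P.Xopt

/-- Dual LP sharpness. -/
def muD : ℝ := lpSharpness P.Vd P.Hd P.Sopt

/-- The set of nonzero singular values of `A`. -/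
def posSingularValues : Set ℝ :=
  {t | t ≠ 0 ∧ ∃ i : ℕ, (Matrix.toEuclideanLin P.A).singularValues i = t}

/-- Largest nonzero singular value of `A`. -/
def lamMax : ℝ := sSup P.posSingularValues

/-- Smallest nonzero singular value of `A`. -/
def lamMin : ℝ := sInf P.posSingularValues

/-- Condition number `κ` of `A`. -/
def kappa : ℝ := P.lamMax / P.lamMin

/-- Distance to optima `max {Dist(x, X*), Dist(s, S*)}`. -/
def errDist (x s : EuclideanSpace ℝ (Fin n)) : ℝ :=
  max (Metric.infDist x P.Xopt) (Metric.infDist s P.Sopt)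

/-- The dual slack `s = c - Aᵀ y`. -/
def slack (y : EuclideanSpace ℝ (Fin m)) : EuclideanSpace ℝ (Fin n) := P.c - P.mulAT y

/-- The Lagrangian `L(x, y) = cᵀx + bᵀy - xᵀAᵀy`. -/
def lagrangian (x : EuclideanSpace ℝ (Fin n)) (y : EuclideanSpace ℝ (Fin m)) : ℝ :=
  inner ℝ P.c x + inner ℝ P.b y - inner ℝ x (P.mulAT y)

/-- One PDHG step with step-sizes `τ`, `σ`. -/
def pdhgStep (τ σ : ℝ) (z : EuclideanSpace ℝ (Fin n) × EuclideanSpace ℝ (Fin m)) :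
    EuclideanSpace ℝ (Fin n) × EuclideanSpace ℝ (Fin m) :=
  let x' := projOrthant (z.1 - τ • (P.c - P.mulAT z.2))
  (x', z.2 + σ • (P.b - P.mulA ((2 : ℝ) • x' - z.1)))

/-- The norm `‖z‖_M = √(zᵀ M z)` with `M = [[τ⁻¹ I, Aᵀ], [A, σ⁻¹ I]]`. For the Lagrangian above
(coupling term `-xᵀAᵀy`) this is the metric in which `pdhgStep` is a proximal point step. -/
def normM (τ σ : ℝ) (z : EuclideanSpace ℝ (Fin n) × EuclideanSpace ℝ (Fin m)) : ℝ :=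
  Real.sqrt (inner ℝ z.1 ((1 / τ) • z.1 + P.mulAT z.2) +
    inner ℝ z.2 (P.mulA z.1 + (1 / σ) • z.2))

/-- The normalized duality gap `ρ(r; z)`, for `r > 0`. -/
def normGap (τ σ r : ℝ) (z : EuclideanSpace ℝ (Fin n) × EuclideanSpace ℝ (Fin m)) : ℝ :=
  (1 / r) * sSup ((fun w : EuclideanSpace ℝ (Fin n) × EuclideanSpace ℝ (Fin m) =>
    P.lagrangian z.1 w.2 - P.lagrangian w.1 z.2) ''
      {w | w.1 ∈ orthant n ∧ P.normM τ σ (w - z) ≤ r})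

end LPData

/-- Memory of rPDHG after a number of PDHG steps: the outer counter `n`, the inner counter `k`, and
the points `z^{n-1,0}`, `z^{n,0}`, `z^{n,k}` and `∑_{i=1}^k z^{n,i}`. -/
structure RState (m n : ℕ) where
  outer : ℕ
  inner : ℕ
  prevStart : EuclideanSpace ℝ (Fin n) × EuclideanSpace ℝ (Fin m)
  start : EuclideanSpace ℝ (Fin n) × EuclideanSpace ℝ (Fin m)
  cur : EuclideanSpace ℝ (Fin n) × EuclideanSpace ℝ (Fin m)
  total : EuclideanSpace ℝ (Fin n) × EuclideanSpace ℝ (Fin m)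

namespace LPData

variable {m n : ℕ} (P : LPData m n)

/-- The `β`-restart condition at iteration `(N, k)`, where `prev = z^{N-1,0}`, `start = z^{N,0}` and
`avg` is the average of the first `k` inner iterates. -/
def restartCond (τ σ β : ℝ) (N k : ℕ)
    (prev start avg : EuclideanSpace ℝ (Fin n) × EuclideanSpace ℝ (Fin m)) : Prop :=
  (N = 0 ∧ k = 1) ∨
  (1 ≤ N ∧ P.normGap τ σ (P.normM τ σ (avg - start)) avg ≤
    β * P.normGap τ σ (P.normM τ σ (start - prev)) start)

/-- Initial state, at `z^{0,0} = z₀` (`prevStart` is not used while `outer = 0`). -/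
def rInit (z₀ : EuclideanSpace ℝ (Fin n) × EuclideanSpace ℝ (Fin m)) : RState m n where
  outer := 0
  inner := 0
  prevStart := z₀
  start := z₀
  cur := z₀
  total := 0

/-- One pass of the inner loop of rPDHG: exactly one PDHG step, the update of the running average
and, when the restart condition holds for the new average, the restart from that average. -/
def rStep (τ σ β : ℝ) (S : RState m n) : RState m n :=
  let z' := P.pdhgStep τ σ S.cur
  let k' := S.inner + 1
  let total' := S.total + z'
  let avg := (1 / (k' : ℝ)) • total'
  open Classical in
  if P.restartCond τ σ β S.outer k' S.prevStart S.start avg then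
    { outer := S.outer + 1, inner := 0, prevStart := S.start, start := avg, cur := avg, total := 0 }
  else
    { outer := S.outer, inner := k', prevStart := S.prevStart, start := S.start, cur := z',
      total := total' }

/-- State of rPDHG, started at `z₀`, after `T` PDHG steps in total. -/
def rPDHG (τ σ β : ℝ) (z₀ : EuclideanSpace ℝ (Fin n) × EuclideanSpace ℝ (Fin m)) (T : ℕ) :
    RState m n :=
  (P.rStep τ σ β)^[T] (rInit z₀)

/-- The numbers `T` of PDHG steps after which rPDHG is at an outer iterate `z^{N,0}`
(i.e. it has just restarted, or `T = 0`) with `max {Dist(x^{N,0}, X*), Dist(s^{N,0}, S*)} ≤ ε`. -/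
def hitTimes (τ σ β : ℝ) (z₀ : EuclideanSpace ℝ (Fin n) × EuclideanSpace ℝ (Fin m)) (ε : ℝ) :
    Set ℕ :=
  {T | (P.rPDHG τ σ β z₀ T).inner = 0 ∧
    P.errDist (P.rPDHG τ σ β z₀ T).start.1 (P.slack (P.rPDHG τ σ β z₀ T).start.2) ≤ ε}

end LPData

end

/-! # Iteration complexity of restarted PDHG for linear programs

A PDHG step is a proximal point step in the `M`-norm. Hence the average of `k` steps from `z⁰` has
duality gap at most `‖w - z⁰‖_M² / (2 k)` against every `w`
(`LPData.IsStepSize.gap_pdhgAvg_le`), and no average is farther from an optimal pair than its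
starting point (`LPData.IsStepSize.normM_pdhgAvg_sub_le`). Consequently the normalized duality gap
of an average is at most `4 D / k`, with `D` a weighted distance of `z⁰` to the optimal pairs
(`LPData.IsScaling.normGap_pdhgAvg_le`).

Conversely the normalized duality gap grows at least linearly with that weighted distance: it bounds
`‖A x - b‖`, the negative part of the slack `s = c - Aᵀ y` and the objective gap, hence the two
objective errors, and these bound the distances to the optimal sets, with the constant
`LPData.growthConst` (`LPData.IsScaling.weightedDist_le`). Here the primal and the dual
are two instances of one problem, the minimization of `⟪g, ·⟫` over `(x₀ + U) ∩ ℝⁿ₊` with `g ∈ U`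
(`IsArgmin`); this is where `A c = 0` enters. The global error bound for it, `IsArgmin.infDist_le`,
involves only the *limiting* error ratio, because a point can be contracted towards its projection
on the optimal set. Hoffman's bound (`exists_hoffman`) shows that the limiting error ratios are
finite limits and that the LP sharpness constants are positive, and Farkas' lemma
(`exists_bounded_farkas`) gives strong duality (`LPData.exists_isArgmin`).

Combining the two estimates, an outer loop restarts after at most `⌈4 e L⌉` steps, where `L` is the
growth constant, and each restart divides the normalized gap at least by `e`
(`LPData.IsScaling.exists_outer`). About `log (4 L G E₀ / ε)` outer loops therefore suffice, where
`G` accounts for passing between the weighted and the unweighted distances, and `6 N = 8.5 L`. -/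

/-! ### Bounded conic representations, Farkas' lemma and Hoffman's bound -/

theorem isClosed_orthant (n : ℕ) : IsClosed (orthant n) := by
  simp only [orthant, Set.ofPred_forall]
  exact isClosed_iInter fun i => isClosed_le continuous_const (by fun_prop)

theorem zero_mem_orthant (n : ℕ) : (0 : EuclideanSpace ℝ (Fin n)) ∈ orthant n := fun _ => le_rfl

theorem add_mem_orthant {n : ℕ} {x y : EuclideanSpace ℝ (Fin n)} (hx : x ∈ orthant n)
    (hy : y ∈ orthant n) : x + y ∈ orthant n := fun i => by
  simpa using add_nonneg (hx i) (hy i)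

theorem smul_mem_orthant {n : ℕ} {x : EuclideanSpace ℝ (Fin n)} {t : ℝ} (ht : 0 ≤ t)
    (hx : x ∈ orthant n) : t • x ∈ orthant n := fun i => by
  simpa using mul_nonneg ht (hx i)

theorem convex_orthant (n : ℕ) : Convex ℝ (orthant n) := fun _ hx _ hy _ _ ha hb _ =>
  add_mem_orthant (smul_mem_orthant ha hx) (smul_mem_orthant hb hy)

theorem inner_nonneg_of_mem_orthant {n : ℕ} {x y : EuclideanSpace ℝ (Fin n)}
    (hx : x ∈ orthant n) (hy : y ∈ orthant n) : 0 ≤ inner ℝ x y := by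
  rw [PiLp.inner_apply]
  exact Finset.sum_nonneg fun i _ => by simpa using mul_nonneg (hy i) (hx i)

/-- A Carathéodory-type statement: the images under a linear map of nonnegative vectors supported
in `s` have nonnegative preimages of proportional norm. If the map is injective on the vectors
supported in `s` this is clear; otherwise a vector of its kernel is used to cancel a coordinate. -/
theorem exists_bounded_preimage_of_support {n : ℕ} {F : Type*} [NormedAddCommGroup F]
    [NormedSpace ℝ F] (f : EuclideanSpace ℝ (Fin n) →ₗ[ℝ] F) (s : Finset (Fin n)) :
    ∃ C : ℝ, 0 ≤ C ∧ ∀ l ∈ orthant n, (∀ i, i ∉ s → l i = 0) →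
      ∃ l' ∈ orthant n, (∀ i, l i = 0 → l' i = 0) ∧ f l' = f l ∧ ‖l'‖ ≤ C * ‖f l‖ := by
  induction s using Finset.strongInduction with
  | H s ih =>
  by_cases hinj : ∀ l : EuclideanSpace ℝ (Fin n), (∀ i, i ∉ s → l i = 0) → f l = 0 → l = 0
  · let W : Submodule ℝ (EuclideanSpace ℝ (Fin n)) :=
      { carrier := {l | ∀ i, i ∉ s → l i = 0}
        add_mem' := fun {a b} ha hb i hi => by simp [ha i hi, hb i hi]
        zero_mem' := fun i _ => rfl
        smul_mem' := fun c a ha i hi => by simp [ha i hi] }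
    have hker : (f.domRestrict W).ker = ⊥ := by
      rw [LinearMap.ker_eq_bot']
      rintro ⟨l, hl⟩ h0
      exact Subtype.ext (hinj l hl h0)
    obtain ⟨K, -, hK⟩ := LinearMap.exists_antilipschitzWith (f.domRestrict W) hker
    refine ⟨K, K.2, fun l hl hs => ⟨l, hl, fun _ h => h, rfl, ?_⟩⟩
    have := hK.le_mul_dist (⟨l, hs⟩ : W) 0
    simpa [dist_eq_norm] using this
  · push Not at hinj
    obtain ⟨μ, hμs, hμ0, hμ⟩ := hinj
    obtain ⟨j, hj⟩ : ∃ j, μ j ≠ 0 := by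
      by_contra! h
      exact hμ (by ext i; exact h i)
    -- after a change of sign, some coordinate of the kernel vector is positive
    wlog hjpos : 0 < μ j generalizing μ
    · exact this (-μ) (fun i hi => by simp [hμs i hi]) (by simp [hμ0]) (by simpa using hμ)
        (by simpa using hj) (by simpa using lt_of_le_of_ne (not_lt.1 hjpos) hj)
    choose! C hC0 hC using ih
    have hle : ∀ i ∈ s, C (s.erase i) ≤ ∑ i ∈ s, C (s.erase i) := fun i hi =>
      Finset.single_le_sum (f := fun i => C (s.erase i))
        (fun i hi => hC0 _ (Finset.erase_ssubset hi)) hi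
    refine ⟨∑ i ∈ s, C (s.erase i),
      Finset.sum_nonneg fun i hi => hC0 _ (Finset.erase_ssubset hi), fun l hl hls => ?_⟩
    have hjs : j ∈ s := by
      by_contra h
      exact hj (hμs j h)
    obtain ⟨k, hk, hkmin⟩ := Finset.exists_min_image (s.filter fun i => 0 < μ i)
      (fun i => l i / μ i) ⟨j, by simp [hjs, hjpos]⟩
    simp only [Finset.mem_filter] at hk hkmin
    by_cases hz : ∃ i ∈ s, l i = 0
    · obtain ⟨i, hi, hli⟩ := hz
      obtain ⟨l', h1, h2, h3, h4⟩ := hC (s.erase i) (Finset.erase_ssubset hi) l hl (fun a ha => by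
        by_cases hai : a = i
        · rw [hai, hli]
        · exact hls a fun h => ha (Finset.mem_erase.2 ⟨hai, h⟩))
      exact ⟨l', h1, h2, h3, h4.trans (by gcongr; exact hle i hi)⟩
    push Not at hz
    have ht : 0 ≤ l k / μ k := div_nonneg (hl k) hk.2.le
    have hmem : l - (l k / μ k) • μ ∈ orthant n := by
      intro i
      simp only [PiLp.sub_apply, PiLp.smul_apply, smul_eq_mul, sub_nonneg]
      by_cases hi : 0 < μ i
      · have his : i ∈ s := by
          by_contra h
          exact hi.ne' (hμs i h)
        exact (le_div_iff₀ hi).1 (hkmin i ⟨his, hi⟩)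
      · exact (mul_nonpos_of_nonneg_of_nonpos ht (not_lt.1 hi)).trans (hl i)
    obtain ⟨l', h1, h2, h3, h4⟩ := hC (s.erase k) (Finset.erase_ssubset hk.1)
      (l - (l k / μ k) • μ) hmem (fun a ha => by
        by_cases hak : a = k
        · subst hak
          simp [hk.2.ne']
        · have has : a ∉ s := fun h => ha (Finset.mem_erase.2 ⟨hak, h⟩)
          simp [hls a has, hμs a has])
    have hf : f (l - (l k / μ k) • μ) = f l := by simp [hμ0]
    rw [hf] at h3 h4
    refine ⟨l', h1, fun i hi => h2 i ?_, h3, h4.trans (by gcongr; exact hle k hk.1)⟩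
    have his : i ∉ s := fun h => hz i h hi
    simp [hi, hμs i his]

/-- The cone of nonnegative vectors supported in `I`. -/
def orthantFace {n : ℕ} (I : Set (Fin n)) : ProperCone ℝ (EuclideanSpace ℝ (Fin n)) where
  carrier := {x | x ∈ orthant n ∧ ∀ i, i ∉ I → x i = 0}
  add_mem' := fun {a b} ha hb =>
    ⟨add_mem_orthant ha.1 hb.1, fun i hi => by simp [ha.2 i hi, hb.2 i hi]⟩
  zero_mem' := ⟨zero_mem_orthant n, fun _ _ => rfl⟩
  smul_mem' := fun c a ha =>
    ⟨smul_mem_orthant c.2 ha.1, fun i hi => by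
      have : (c • a) i = (c : ℝ) * a i := rfl
      rw [this, ha.2 i hi, mul_zero]⟩
  isClosed' := by
    have h : IsClosed {x : EuclideanSpace ℝ (Fin n) | ∀ i, i ∉ I → x i = 0} := by
      simp only [Set.ofPred_forall]
      exact isClosed_iInter fun i => isClosed_iInter fun _ =>
        isClosed_eq (by fun_prop) continuous_const
    exact (isClosed_orthant n).inter h

/-- Farkas' lemma relative to a subspace `U`, with a bound on the multiplier that depends on `U`
only. The bound comes from `exists_bounded_preimage_of_support`, which also shows that the cone
spanned by the projections of the unit vectors is closed. -/
theorem exists_bounded_farkas {n : ℕ} (U : Submodule ℝ (EuclideanSpace ℝ (Fin n))) :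
    ∃ C : ℝ, 0 ≤ C ∧ ∀ (I : Set (Fin n)), ∀ g ∈ U,
      (∀ d ∈ U, (∀ i ∈ I, 0 ≤ d i) → 0 ≤ inner ℝ g d) →
      ∃ s ∈ orthant n, (∀ i, i ∉ I → s i = 0) ∧ g - s ∈ Uᗮ ∧ ‖s‖ ≤ C * ‖g‖ := by
  obtain ⟨C, hC0, hC⟩ := exists_bounded_preimage_of_support
    (U.starProjection : EuclideanSpace ℝ (Fin n) →ₗ[ℝ] EuclideanSpace ℝ (Fin n)) Finset.univ
  refine ⟨C, hC0, fun I g hg hd => ?_⟩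
  have hadj : ∀ x y : EuclideanSpace ℝ (Fin n),
      inner ℝ (U.starProjection x) y = inner ℝ x (U.starProjection y) := fun x y =>
    Submodule.inner_starProjection_left_eq_right U x y
  have hgmap : g ∈ (orthantFace I).map U.starProjection := by
    rw [ProperCone.relative_hyperplane_separation]
    intro y hy
    have hy' : ∀ x ∈ orthantFace I, 0 ≤ inner ℝ x (U.starProjection y) := by
      intro x hx
      have := hy hx
      simpa [ContinuousLinearMap.adjoint_inner_right, hadj] using this
    have := hd (U.starProjection y) (Submodule.starProjection_apply_mem U y) (fun i hi => by
      have := hy' (EuclideanSpace.single i 1) ⟨fun j => by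
        by_cases h : j = i <;> simp [h], fun j hj => by
        have : j ≠ i := fun h => hj (h ▸ hi)
        simp [this]⟩
      simpa [EuclideanSpace.inner_single_left] using this)
    rwa [← hadj, Submodule.starProjection_eq_self_iff.2 hg] at this
  have hcl : g ∈ closure (U.starProjection '' (orthantFace I : Set (EuclideanSpace ℝ (Fin n)))) := by
    simpa using hgmap
  obtain ⟨u, hu, hulim⟩ := mem_closure_iff_seq_limit.1 hcl
  have hex : ∀ k, ∃ l ∈ orthantFace I, U.starProjection l = u k ∧ ‖l‖ ≤ C * ‖u k‖ := by
    intro k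
    obtain ⟨l, hl, hlu⟩ := hu k
    obtain ⟨l', h1, h2, h3, h4⟩ := hC l hl.1 (by simp)
    refine ⟨l', ⟨h1, fun i hi => h2 i (hl.2 i hi)⟩, ?_, ?_⟩
    · rw [← hlu]; exact h3
    · rw [← hlu]; exact h4
  choose l hl hlu hlC using hex
  obtain ⟨B, hB⟩ := (Metric.isBounded_range_of_tendsto u hulim).exists_norm_le
  have hlb : ∀ k, l k ∈ Metric.closedBall (0 : EuclideanSpace ℝ (Fin n)) (C * B) := fun k => by
    rw [mem_closedBall_zero_iff]
    exact (hlC k).trans (mul_le_mul_of_nonneg_left (hB _ ⟨k, rfl⟩) hC0)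
  obtain ⟨s, -, φ, hφ, hs⟩ := (isCompact_closedBall _ _).tendsto_subseq hlb
  have hsI : s ∈ orthantFace I :=
    (orthantFace I).isClosed.mem_of_tendsto hs (Filter.Eventually.of_forall fun k => hl (φ k))
  have hulim' := hulim.comp hφ.tendsto_atTop
  have hPs : U.starProjection s = g := by
    refine tendsto_nhds_unique ((U.starProjection.continuous.tendsto s).comp hs) ?_
    refine hulim'.congr fun k => ?_
    simp [hlu]
  refine ⟨s, hsI.1, hsI.2, ?_, ?_⟩
  · rw [← hPs, ← neg_sub]
    exact Uᗮ.neg_mem (Submodule.sub_starProjection_mem_orthogonal s)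
  · exact le_of_tendsto_of_tendsto' hs.norm (hulim'.norm.const_mul C) fun k => hlC (φ k)

/-- The componentwise negative part. -/
def negPart {n : ℕ} (x : EuclideanSpace ℝ (Fin n)) : EuclideanSpace ℝ (Fin n) :=
  WithLp.toLp 2 (fun i => max (-x i) 0)

theorem negPart_apply {n : ℕ} (x : EuclideanSpace ℝ (Fin n)) (i : Fin n) :
    negPart x i = max (-x i) 0 := rfl

theorem projOrthant_apply {n : ℕ} (x : EuclideanSpace ℝ (Fin n)) (i : Fin n) :
    projOrthant x i = max (x i) 0 := rfl

theorem negPart_mem_orthant {n : ℕ} (x : EuclideanSpace ℝ (Fin n)) : negPart x ∈ orthant n :=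
  fun _ => le_max_right _ _

theorem projOrthant_mem_orthant {n : ℕ} (x : EuclideanSpace ℝ (Fin n)) :
    projOrthant x ∈ orthant n := fun _ => le_max_right _ _

theorem add_negPart_mem_orthant {n : ℕ} (x : EuclideanSpace ℝ (Fin n)) :
    x + negPart x ∈ orthant n := fun i => by
  simp only [PiLp.add_apply, negPart_apply]
  linarith [le_max_left (-x i) 0]

theorem inner_negPart_self {n : ℕ} (x : EuclideanSpace ℝ (Fin n)) :
    inner ℝ x (negPart x) = -‖negPart x‖ ^ 2 := by
  rw [← real_inner_self_eq_norm_sq, PiLp.inner_apply, PiLp.inner_apply, ← Finset.sum_neg_distrib]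
  refine Finset.sum_congr rfl fun i _ => ?_
  simp only [negPart_apply, RCLike.inner_apply, conj_trivial]
  rcases le_total (x i) 0 with h | h
  · rw [max_eq_left (by linarith)]; ring
  · rw [max_eq_right (by linarith)]; ring

/-- For `s ≥ 0` and any `x`, `-⟪s, x⟫` is controlled by the negative part of `x`. -/
theorem neg_inner_le_norm_negPart {n : ℕ} {s : EuclideanSpace ℝ (Fin n)} (hs : s ∈ orthant n)
    (x : EuclideanSpace ℝ (Fin n)) : -inner ℝ s x ≤ ‖s‖ * ‖negPart x‖ := by
  have h := inner_nonneg_of_mem_orthant hs (add_negPart_mem_orthant x)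
  rw [inner_add_right] at h
  linarith [real_inner_le_norm s (negPart x)]

theorem norm_negPart_eq_infDist {n : ℕ} (x : EuclideanSpace ℝ (Fin n)) :
    ‖negPart x‖ = Metric.infDist x (orthant n) := by
  apply le_antisymm
  · refine (Metric.le_infDist ⟨0, zero_mem_orthant n⟩).2 fun y hy => ?_
    -- each coordinate of `negPart x` is at most the corresponding one of `x - y`
    rw [dist_eq_norm, EuclideanSpace.norm_eq, EuclideanSpace.norm_eq]
    refine Real.sqrt_le_sqrt (Finset.sum_le_sum fun i _ => ?_)
    refine pow_le_pow_left₀ (norm_nonneg _) ?_ 2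
    rw [negPart_apply, Real.norm_eq_abs, Real.norm_eq_abs, abs_of_nonneg (le_max_right _ _),
      PiLp.sub_apply]
    exact max_le (by linarith [neg_abs_le (x i - y i), hy i]) (abs_nonneg _)
  · refine (Metric.infDist_le_dist_of_mem (add_negPart_mem_orthant x)).trans_eq ?_
    simp [dist_eq_norm]

/-- Affine translates of a subspace, as plain sets. -/
def affineSet {n : ℕ} (x₀ : EuclideanSpace ℝ (Fin n))
    (U : Submodule ℝ (EuclideanSpace ℝ (Fin n))) : Set (EuclideanSpace ℝ (Fin n)) :=
  {x | x - x₀ ∈ U}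

theorem isClosed_affineSet {n : ℕ} (x₀ : EuclideanSpace ℝ (Fin n))
    (U : Submodule ℝ (EuclideanSpace ℝ (Fin n))) : IsClosed (affineSet x₀ U) :=
  U.closed_of_finiteDimensional.preimage (by fun_prop : Continuous fun x => x - x₀)

theorem sub_mem_of_mem_affineSet {n : ℕ} {x₀ x y : EuclideanSpace ℝ (Fin n)}
    {U : Submodule ℝ (EuclideanSpace ℝ (Fin n))} (hx : x ∈ affineSet x₀ U)
    (hy : y ∈ affineSet x₀ U) : x - y ∈ U := by
  simpa using U.sub_mem hx hy

theorem add_mem_affineSet {n : ℕ} {x₀ x d : EuclideanSpace ℝ (Fin n)}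
    {U : Submodule ℝ (EuclideanSpace ℝ (Fin n))} (hx : x ∈ affineSet x₀ U)
    (hd : d ∈ U) : x + d ∈ affineSet x₀ U := by
  have : x + d - x₀ = (x - x₀) + d := by abel
  change x + d - x₀ ∈ U
  rw [this]
  exact U.add_mem hx hd

theorem convex_affineSet {n : ℕ} (x₀ : EuclideanSpace ℝ (Fin n))
    (U : Submodule ℝ (EuclideanSpace ℝ (Fin n))) : Convex ℝ (affineSet x₀ U) := by
  intro x hx y hy a b _ _ hab
  have : a • x + b • y = x + b • (y - x) := by
    rw [← eq_sub_iff_add_eq] at hab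
    rw [hab, smul_sub, sub_smul, one_smul]; abel
  rw [this]
  exact add_mem_affineSet hx (U.smul_mem _ (sub_mem_of_mem_affineSet hy hx))

/-- A direction that is nonnegative on the active coordinates of `p ≥ 0` can be followed from `p`
for a positive time without leaving the orthant. -/
theorem exists_pos_add_smul_mem_orthant {n : ℕ} {p d : EuclideanSpace ℝ (Fin n)}
    (hp : p ∈ orthant n) (hd : ∀ i, p i = 0 → 0 ≤ d i) :
    ∃ t : ℝ, 0 < t ∧ t ≤ 1 ∧ p + t • d ∈ orthant n := by
  have h : ∀ i, ∀ᶠ t : ℝ in nhdsWithin 0 (Set.Ioi 0), 0 ≤ p i + t * d i := by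
    intro i
    rcases (hp i).eq_or_lt with h0 | h0
    · filter_upwards [self_mem_nhdsWithin] with t ht
      rw [← h0, zero_add]
      exact mul_nonneg (le_of_lt ht) (hd i h0.symm)
    · have : Filter.Tendsto (fun t : ℝ => p i + t * d i) (nhdsWithin 0 (Set.Ioi 0))
          (nhds (p i + 0 * d i)) :=
        (Continuous.tendsto (by fun_prop) 0).mono_left nhdsWithin_le_nhds
      filter_upwards [this.eventually (lt_mem_nhds (by simpa using h0))] with t ht
      exact le_of_lt ht
  have h1 : ∀ᶠ t : ℝ in nhdsWithin 0 (Set.Ioi 0), t ≤ 1 :=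
    nhdsWithin_le_nhds (ge_mem_nhds zero_lt_one)
  obtain ⟨t, h2, ht0, ht1⟩ :=
    ((Filter.eventually_all.2 h).and (Filter.Eventually.and self_mem_nhdsWithin h1)).exists
  exact ⟨t, ht0, ht1, fun i => by simpa using h2 i⟩

/-- Hoffman's error bound for the intersection of an affine set and the orthant. With `p` the
projection of `x`, optimality of `p` and `exists_bounded_farkas` give a multiplier `s` such that
`‖p - x‖² = -⟪s, x⟫`. -/
theorem exists_hoffman {n : ℕ} (x₀ : EuclideanSpace ℝ (Fin n))
    (U : Submodule ℝ (EuclideanSpace ℝ (Fin n))) (hne : (affineSet x₀ U ∩ orthant n).Nonempty) :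
    ∃ C : ℝ, 0 ≤ C ∧ ∀ x ∈ affineSet x₀ U,
      Metric.infDist x (affineSet x₀ U ∩ orthant n) ≤ C * Metric.infDist x (orthant n) := by
  obtain ⟨C, hC0, hC⟩ := exists_bounded_farkas U
  refine ⟨C, hC0, fun x hx => ?_⟩
  have hcl : IsClosed (affineSet x₀ U ∩ orthant n) :=
    (isClosed_affineSet x₀ U).inter (isClosed_orthant n)
  have hconv : Convex ℝ (affineSet x₀ U ∩ orthant n) :=
    (convex_affineSet x₀ U).inter (convex_orthant n)
  obtain ⟨p, hp, hpd⟩ := exists_norm_eq_iInf_of_complete_convex hne hcl.isComplete hconv x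
  rw [norm_eq_iInf_iff_real_inner_le_zero hconv hp] at hpd
  have hpx : p - x ∈ U := sub_mem_of_mem_affineSet hp.1 hx
  obtain ⟨s, hs, hsI, hgs, hsn⟩ := hC {i | p i = 0} (p - x) hpx (fun d hd hdI => by
    obtain ⟨t, ht, -, htm⟩ := exists_pos_add_smul_mem_orthant hp.2 hdI
    have := hpd _ ⟨add_mem_affineSet hp.1 (U.smul_mem t hd), htm⟩
    rw [add_sub_cancel_left, inner_smul_right] at this
    have h2 : inner ℝ (x - p) d ≤ 0 := by
      by_contra! h
      linarith [mul_pos ht h]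
    rw [← neg_sub, inner_neg_left]
    linarith)
  have hsp : inner ℝ s p = 0 := by
    rw [PiLp.inner_apply]
    refine Finset.sum_eq_zero fun i _ => ?_
    by_cases hi : p i = 0
    · simp [hi]
    · simp [hsI i hi]
  have h1 : ‖p - x‖ ^ 2 = -inner ℝ s x := by
    have h2 : inner ℝ (p - x - s) (p - x) = 0 := Submodule.inner_left_of_mem_orthogonal hpx hgs
    rw [inner_sub_left, real_inner_self_eq_norm_sq, inner_sub_right, hsp] at h2
    linarith
  have h3 := neg_inner_le_norm_negPart hs x
  have h4 : ‖p - x‖ ≤ C * ‖negPart x‖ := by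
    by_contra! h
    have hpos : 0 < ‖p - x‖ := lt_of_le_of_lt (by positivity) h
    have : ‖s‖ * ‖negPart x‖ ≤ C * ‖p - x‖ * ‖negPart x‖ := by gcongr
    nlinarith [mul_pos hpos (sub_pos.2 h)]
  calc Metric.infDist x (affineSet x₀ U ∩ orthant n) ≤ dist x p := Metric.infDist_le_dist_of_mem hp
    _ = ‖p - x‖ := by rw [dist_comm, dist_eq_norm]
    _ ≤ _ := by rw [← norm_negPart_eq_infDist]; exact h4

/-! ### The error ratio, LP sharpness and a global error bound -/

theorem infDist_le_errorRatio_mul {n : ℕ} {V : Set (EuclideanSpace ℝ (Fin n))}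
    {x : EuclideanSpace ℝ (Fin n)} (hx : x ∈ V) :
    Metric.infDist x (V ∩ orthant n) ≤ errorRatio V x * Metric.infDist x (orthant n) := by
  unfold errorRatio
  split_ifs with h
  · rw [Metric.infDist_zero_of_mem h, one_mul]
    exact Metric.infDist_nonneg
  · have hpos : 0 < Metric.infDist x (orthant n) :=
      ((isClosed_orthant n).notMem_iff_infDist_pos ⟨0, zero_mem_orthant n⟩).1
        fun hxo => h ⟨hx, hxo⟩
    rw [div_mul_cancel₀ _ hpos.ne']

/-- By Hoffman's bound the supremum in `limitingER` is finite and monotone in the radius, so the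
limit exists; it is at least `1` and bounds the error ratio near `S` up to any `η > 0`. -/
theorem limitingER_spec {n : ℕ} {x₀ : EuclideanSpace ℝ (Fin n)}
    {U : Submodule ℝ (EuclideanSpace ℝ (Fin n))} {S : Set (EuclideanSpace ℝ (Fin n))}
    (hne : S.Nonempty) (hS : S ⊆ affineSet x₀ U ∩ orthant n) :
    1 ≤ limitingER (affineSet x₀ U) S ∧ ∀ η > 0, ∃ δ > 0, ∀ x ∈ affineSet x₀ U,
      Metric.infDist x S ≤ δ →
        errorRatio (affineSet x₀ U) x ≤ limitingER (affineSet x₀ U) S + η := by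
  obtain ⟨C, hC0, hC⟩ := exists_hoffman x₀ U (hne.mono hS)
  set V := affineSet x₀ U with hV
  have hnn : ∀ x, 0 ≤ errorRatio V x := fun x => by
    unfold errorRatio
    split_ifs
    · exact zero_le_one
    · exact div_nonneg Metric.infDist_nonneg Metric.infDist_nonneg
  have hub : ∀ x ∈ V, errorRatio V x ≤ max 1 C := by
    intro x hx
    unfold errorRatio
    split_ifs with h
    · exact le_max_left _ _
    · exact (div_le_of_le_mul₀ Metric.infDist_nonneg hC0 (hC x hx)).trans (le_max_right _ _)
  set φ : ℝ → ℝ := fun ε => sSup (errorRatio V '' {x | x ∈ V ∧ Metric.infDist x S ≤ ε}) with hφ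
  have hbdd : ∀ ε, BddAbove (errorRatio V '' {x | x ∈ V ∧ Metric.infDist x S ≤ ε}) := fun ε =>
    ⟨max 1 C, by rintro _ ⟨x, hx, rfl⟩; exact hub x hx.1⟩
  have hmono : Monotone φ := by
    intro ε ε' h
    refine Real.sSup_le ?_ (Real.sSup_nonneg (by rintro _ ⟨x, -, rfl⟩; exact hnn x))
    rintro _ ⟨x, hx, rfl⟩
    exact le_csSup (hbdd ε') ⟨x, ⟨hx.1, hx.2.trans h⟩, rfl⟩
  have hlim : Filter.Tendsto φ (nhdsWithin 0 (Set.Ioi 0)) (nhds (sInf (φ '' Set.Ioi 0))) :=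
    hmono.tendsto_nhdsGT 0
  have heq : limitingER V S = sInf (φ '' Set.Ioi 0) := hlim.limUnder_eq
  obtain ⟨p, hp⟩ := hne
  have hone : ∀ ε > 0, 1 ≤ φ ε := by
    intro ε hε
    have h1 : errorRatio V p = 1 := if_pos (hS hp)
    rw [← h1]
    exact le_csSup (hbdd ε) ⟨p, ⟨(hS hp).1, by rw [Metric.infDist_zero_of_mem hp]; exact hε.le⟩, rfl⟩
  rw [heq]
  constructor
  · refine le_csInf ⟨_, 1, Set.mem_Ioi.2 one_pos, rfl⟩ ?_
    rintro _ ⟨ε, hε, rfl⟩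
    exact hone ε hε
  · intro η hη
    obtain ⟨δ, hδ, hδpos⟩ := ((hlim.eventually (gt_mem_nhds (lt_add_of_pos_right _ hη))).and
      (self_mem_nhdsWithin : Set.Ioi (0 : ℝ) ∈ nhdsWithin 0 (Set.Ioi 0))).exists
    exact ⟨δ, hδpos, fun x hx hxδ => (le_csSup (hbdd δ) ⟨x, ⟨hx, hxδ⟩, rfl⟩).trans hδ.le⟩

/-- `S` is the nonempty set of minimizers of `⟪g, ·⟫` over `(x₀ + U) ∩ ℝⁿ₊`, `f` is the minimal
value, `H` its level set, the objective `g` lies in `U`, and not all feasible points are optimal. -/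
structure IsArgmin {n : ℕ} (x₀ : EuclideanSpace ℝ (Fin n))
    (U : Submodule ℝ (EuclideanSpace ℝ (Fin n))) (g : EuclideanSpace ℝ (Fin n)) (f : ℝ)
    (H S : Set (EuclideanSpace ℝ (Fin n))) : Prop where
  mem_dir : g ∈ U
  mem_iff : ∀ x, x ∈ S ↔ x ∈ affineSet x₀ U ∩ orthant n ∧ inner ℝ g x = f
  le : ∀ x ∈ affineSet x₀ U ∩ orthant n, f ≤ inner ℝ g x
  level : ∀ x, x ∈ H ↔ inner ℝ g x = f
  nonempty : S.Nonempty
  exists_nonopt : ((affineSet x₀ U ∩ orthant n) \ S).Nonempty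

namespace IsArgmin

variable {n : ℕ} {x₀ : EuclideanSpace ℝ (Fin n)} {U : Submodule ℝ (EuclideanSpace ℝ (Fin n))}
  {g : EuclideanSpace ℝ (Fin n)} {f : ℝ} {H S : Set (EuclideanSpace ℝ (Fin n))}

theorem subset (h : IsArgmin x₀ U g f H S) : S ⊆ affineSet x₀ U ∩ orthant n :=
  fun x hx => ((h.mem_iff x).1 hx).1

theorem isClosed (h : IsArgmin x₀ U g f H S) : IsClosed S := by
  have : S = (affineSet x₀ U ∩ orthant n) ∩ {x | inner ℝ g x = f} := Set.ext h.mem_iff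
  rw [this]
  exact ((isClosed_affineSet x₀ U).inter (isClosed_orthant n)).inter
    (isClosed_eq (by fun_prop) continuous_const)

theorem g_ne_zero (h : IsArgmin x₀ U g f H S) : g ≠ 0 := by
  rintro rfl
  obtain ⟨x, hx, hxS⟩ := h.exists_nonopt
  obtain ⟨y, hy⟩ := h.nonempty
  refine hxS ((h.mem_iff x).2 ⟨hx, ?_⟩)
  simpa using ((h.mem_iff y).1 hy).2

theorem inter_level_eq (h : IsArgmin x₀ U g f H S) {p : EuclideanSpace ℝ (Fin n)} (hp : p ∈ S) :
    affineSet x₀ U ∩ H = affineSet p (U ⊓ (ℝ ∙ g)ᗮ) := by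
  have hp' := (h.mem_iff p).1 hp
  ext x
  have h1 : x - p ∈ (ℝ ∙ g)ᗮ ↔ x ∈ H := by
    rw [Submodule.mem_orthogonal_singleton_iff_inner_right, h.level, inner_sub_right, hp'.2,
      sub_eq_zero]
  have h2 : x - p ∈ U ↔ x ∈ affineSet x₀ U := by
    constructor
    · intro hx
      simpa using add_mem_affineSet hp'.1.1 hx
    · exact fun hx => sub_mem_of_mem_affineSet hx hp'.1.1
  change _ ↔ x - p ∈ U ⊓ (ℝ ∙ g)ᗮ
  rw [Submodule.mem_inf, h1, h2]
  rfl

/-- LP sharpness is positive: this is Hoffman's bound for the optimal set, which is the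
intersection of `V ∩ H` with the orthant. -/
theorem lpSharpness_pos (h : IsArgmin x₀ U g f H S) : 0 < lpSharpness (affineSet x₀ U) H S := by
  obtain ⟨p, hp⟩ := h.nonempty
  have hSeq : S = affineSet p (U ⊓ (ℝ ∙ g)ᗮ) ∩ orthant n := by
    rw [← h.inter_level_eq hp]
    ext x
    rw [h.mem_iff, ← h.level]
    simp only [Set.mem_inter_iff]
    tauto
  obtain ⟨C, hC0, hC⟩ := exists_hoffman p (U ⊓ (ℝ ∙ g)ᗮ) (hSeq ▸ h.nonempty)
  have hne : (affineSet p (U ⊓ (ℝ ∙ g)ᗮ)).Nonempty := ⟨p, by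
    change p - p ∈ U ⊓ (ℝ ∙ g)ᗮ
    rw [sub_self]
    exact zero_mem _⟩
  refine lt_of_lt_of_le (by positivity : 0 < 1 / (1 + C)) (le_csInf (h.exists_nonopt.image _) ?_)
  rintro _ ⟨x, ⟨hx, hxS⟩, rfl⟩
  have hpos : 0 < Metric.infDist x S := (h.isClosed.notMem_iff_infDist_pos h.nonempty).1 hxS
  simp only
  rw [div_le_div_iff₀ (by positivity) hpos, one_mul, h.inter_level_eq hp]
  obtain ⟨y, hy, hyd⟩ := (isClosed_affineSet p (U ⊓ (ℝ ∙ g)ᗮ)).exists_infDist_eq_dist hne x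
  rw [hyd]
  have h1 := hC y hy
  rw [← hSeq] at h1
  have h2 : Metric.infDist y (orthant n) ≤ dist x y := by
    rw [dist_comm]
    exact Metric.infDist_le_dist_of_mem hx.2
  have h3 : Metric.infDist x S ≤ Metric.infDist y S + dist x y := Metric.infDist_le_infDist_add_dist
  nlinarith [mul_le_mul_of_nonneg_left h2 hC0]

theorem lpSharpness_mul_le (h : IsArgmin x₀ U g f H S) {x : EuclideanSpace ℝ (Fin n)}
    (hx : x ∈ affineSet x₀ U ∩ orthant n) :
    lpSharpness (affineSet x₀ U) H S * Metric.infDist x S ≤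
      Metric.infDist x (affineSet x₀ U ∩ H) := by
  by_cases hxS : x ∈ S
  · rw [Metric.infDist_zero_of_mem hxS, mul_zero]
    exact Metric.infDist_nonneg
  · have hpos : 0 < Metric.infDist x S := (h.isClosed.notMem_iff_infDist_pos h.nonempty).1 hxS
    rw [← le_div_iff₀ hpos]
    refine csInf_le ⟨0, ?_⟩ ⟨x, ⟨hx, hxS⟩, rfl⟩
    rintro _ ⟨y, -, rfl⟩
    exact div_nonneg Metric.infDist_nonneg Metric.infDist_nonneg

theorem lpSharpness_le_one (h : IsArgmin x₀ U g f H S) :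
    lpSharpness (affineSet x₀ U) H S ≤ 1 := by
  obtain ⟨x, hx, hxS⟩ := h.exists_nonopt
  have hpos : 0 < Metric.infDist x S := (h.isClosed.notMem_iff_infDist_pos h.nonempty).1 hxS
  have h1 := h.lpSharpness_mul_le hx
  have h2 : Metric.infDist x (affineSet x₀ U ∩ H) ≤ Metric.infDist x S := by
    refine Metric.infDist_le_infDist_of_subset (fun y hy => ?_) h.nonempty
    have := (h.mem_iff y).1 hy
    exact ⟨this.1.1, (h.level y).2 this.2⟩
  by_contra! h3
  nlinarith [mul_pos (sub_pos.2 h3) hpos]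

/-- On the affine hull the distance to the optimal level set is governed by the objective gap,
because the objective vector is a direction of the affine set. -/
theorem infDist_level_le (h : IsArgmin x₀ U g f H S) {x : EuclideanSpace ℝ (Fin n)}
    (hx : x ∈ affineSet x₀ U ∩ orthant n) :
    Metric.infDist x (affineSet x₀ U ∩ H) ≤ (inner ℝ g x - f) / ‖g‖ := by
  have hg : 0 < ‖g‖ := norm_pos_iff.2 h.g_ne_zero
  set t := (inner ℝ g x - f) / ‖g‖ ^ 2 with ht
  have ht0 : 0 ≤ t := div_nonneg (sub_nonneg.2 (h.le x hx)) (by positivity)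
  have hmem : x + (-t) • g ∈ affineSet x₀ U ∩ H := by
    refine ⟨add_mem_affineSet hx.1 (U.smul_mem _ h.mem_dir), (h.level _).2 ?_⟩
    rw [inner_add_right, inner_smul_right, real_inner_self_eq_norm_sq, ht]
    field_simp
    ring
  refine (Metric.infDist_le_dist_of_mem hmem).trans_eq ?_
  rw [dist_eq_norm, sub_add_cancel_left, norm_neg, norm_smul, norm_neg, Real.norm_eq_abs,
    abs_of_nonneg ht0, ht]
  field_simp

/-- The error bound with the error ratio of the point itself. -/
theorem lpSharpness_mul_infDist_le (h : IsArgmin x₀ U g f H S) {x : EuclideanSpace ℝ (Fin n)}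
    (hx : x ∈ affineSet x₀ U) :
    lpSharpness (affineSet x₀ U) H S * Metric.infDist x S ≤
      2 * (errorRatio (affineSet x₀ U) x * Metric.infDist x (orthant n)) +
        max (inner ℝ g x - f) 0 / ‖g‖ := by
  have hg : 0 < ‖g‖ := norm_pos_iff.2 h.g_ne_zero
  obtain ⟨y, hy, hyd⟩ := ((isClosed_affineSet x₀ U).inter
    (isClosed_orthant n)).exists_infDist_eq_dist (h.nonempty.mono h.subset) x
  have h1 := infDist_le_errorRatio_mul hx
  rw [hyd] at h1
  have h2 := (h.lpSharpness_mul_le hy).trans (h.infDist_level_le hy)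
  have h3 : Metric.infDist x S ≤ Metric.infDist y S + dist x y := Metric.infDist_le_infDist_add_dist
  have h4 : inner ℝ g y - f ≤ max (inner ℝ g x - f) 0 + ‖g‖ * dist x y := by
    have : inner ℝ g y = inner ℝ g x + inner ℝ g (y - x) := by rw [inner_sub_right]; ring
    have h5 := real_inner_le_norm g (y - x)
    rw [← dist_eq_norm, dist_comm] at h5
    linarith [le_max_left (inner ℝ g x - f) 0]
  have h5 : (inner ℝ g y - f) / ‖g‖ ≤ max (inner ℝ g x - f) 0 / ‖g‖ + dist x y := by
    calc (inner ℝ g y - f) / ‖g‖ ≤ (max (inner ℝ g x - f) 0 + ‖g‖ * dist x y) / ‖g‖ := by gcongr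
      _ = _ := by field_simp
  have h6 := h.lpSharpness_pos
  have h7 := h.lpSharpness_le_one
  have h8 : lpSharpness (affineSet x₀ U) H S * dist x y ≤ dist x y :=
    mul_le_of_le_one_left dist_nonneg h7
  have h9 := mul_le_mul_of_nonneg_left h3 h6.le
  rw [mul_add] at h9
  linarith

/-- The global error bound in terms of the *limiting* error ratio. Shrinking `x` towards its
projection on the optimal set scales the distance to the optimal set and the objective gap by the
same factor and the distance to the orthant by at most that factor, so it suffices to know the
error ratio close to the optimal set. -/
theorem infDist_le (h : IsArgmin x₀ U g f H S) {x : EuclideanSpace ℝ (Fin n)}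
    (hx : x ∈ affineSet x₀ U) :
    Metric.infDist x S ≤ 1 / lpSharpness (affineSet x₀ U) H S *
      (2 * limitingER (affineSet x₀ U) S * Metric.infDist x (orthant n) +
        max (inner ℝ g x - f) 0 / ‖g‖) := by
  have hμ := h.lpSharpness_pos
  rw [one_div, ← div_eq_inv_mul, le_div_iff₀ hμ, mul_comm]
  obtain ⟨-, hθ⟩ := limitingER_spec h.nonempty h.subset
  obtain ⟨p, hp, hpd⟩ := h.isClosed.exists_infDist_eq_dist h.nonempty x
  have hp' := (h.mem_iff p).1 hp
  refine le_of_forall_pos_le_add fun ε hε => ?_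
  set a := Metric.infDist x (orthant n) with ha
  have ha0 : 0 ≤ a := Metric.infDist_nonneg
  obtain ⟨δ, hδ, hδx⟩ := hθ (ε / (2 * (a + 1))) (by positivity)
  set D := Metric.infDist x S with hD
  have hD0 : 0 ≤ D := Metric.infDist_nonneg
  set t := min 1 (δ / (D + 1)) with ht
  have ht0 : 0 < t := by positivity
  have ht1 : t ≤ 1 := min_le_left _ _
  have htδ : t * D ≤ δ := by
    have : t ≤ δ / (D + 1) := min_le_right _ _
    rw [le_div_iff₀ (by positivity)] at this
    nlinarith
  set xt := p + t • (x - p) with hxt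
  have hxtV : xt ∈ affineSet x₀ U :=
    add_mem_affineSet hp'.1.1 (U.smul_mem _ (sub_mem_of_mem_affineSet hx hp'.1.1))
  have hxxt : dist x xt = (1 - t) * D := by
    have : x - xt = (1 - t) • (x - p) := by rw [hxt, sub_smul, one_smul]; abel
    rw [dist_eq_norm, this, norm_smul, Real.norm_eq_abs, abs_of_nonneg (by linarith), hpd,
      dist_eq_norm]
  have hlow : t * D ≤ Metric.infDist xt S := by
    have : D ≤ Metric.infDist xt S + dist x xt := Metric.infDist_le_infDist_add_dist
    rw [hxxt] at this
    linarith
  have hup : Metric.infDist xt S ≤ δ := by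
    refine (Metric.infDist_le_dist_of_mem hp).trans (le_trans (le_of_eq ?_) htδ)
    rw [dist_eq_norm, hxt, add_sub_cancel_left, norm_smul, Real.norm_eq_abs, abs_of_pos ht0, hpd,
      dist_eq_norm]
  have horth : Metric.infDist xt (orthant n) ≤ t * a := by
    obtain ⟨y, hy, hyd⟩ := (isClosed_orthant n).exists_infDist_eq_dist ⟨0, zero_mem_orthant n⟩ x
    have hmem : (1 - t) • p + t • y ∈ orthant n :=
      convex_orthant n hp'.1.2 hy (by linarith) ht0.le (by ring)
    refine (Metric.infDist_le_dist_of_mem hmem).trans_eq ?_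
    have : xt - ((1 - t) • p + t • y) = t • (x - y) := by
      rw [hxt, sub_smul, one_smul, smul_sub, smul_sub]; abel
    rw [dist_eq_norm, this, norm_smul, Real.norm_eq_abs, abs_of_pos ht0, ha, hyd, dist_eq_norm]
  have hgap : max (inner ℝ g xt - f) 0 = t * max (inner ℝ g x - f) 0 := by
    have : inner ℝ g xt - f = t * (inner ℝ g x - f) := by
      rw [hxt, inner_add_right, inner_smul_right, inner_sub_right, hp'.2]; ring
    rw [this, mul_max_of_nonneg _ _ ht0.le, mul_zero]
  have hmain := h.lpSharpness_mul_infDist_le hxtV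
  rw [hgap] at hmain
  have her := hδx xt hxtV hup
  set θ := limitingER (affineSet x₀ U) S
  set μ := lpSharpness (affineSet x₀ U) H S
  have hη : 0 < ε / (2 * (a + 1)) := by positivity
  have hθ1 : 1 ≤ θ := (limitingER_spec h.nonempty h.subset).1
  have h1 : errorRatio (affineSet x₀ U) xt * Metric.infDist xt (orthant n) ≤
      (θ + ε / (2 * (a + 1))) * (t * a) :=
    mul_le_mul her horth Metric.infDist_nonneg (by positivity)
  have h2 : μ * (t * D) ≤ μ * Metric.infDist xt S := mul_le_mul_of_nonneg_left hlow hμ.le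
  have h3 : ε / (2 * (a + 1)) * a ≤ ε / 2 := by
    rw [div_mul_eq_mul_div, div_le_div_iff₀ (by positivity) two_pos]
    nlinarith
  have h4 : t * (μ * D) ≤
      t * (2 * θ * a + max (inner ℝ g x - f) 0 / ‖g‖ + 2 * (ε / (2 * (a + 1)) * a)) := by
    calc t * (μ * D) = μ * (t * D) := by ring
      _ ≤ _ := h2
      _ ≤ _ := hmain
      _ ≤ 2 * ((θ + ε / (2 * (a + 1))) * (t * a)) + t * max (inner ℝ g x - f) 0 / ‖g‖ := by gcongr
      _ = _ := by ring
  have h5 := le_of_mul_le_mul_left h4 ht0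
  linarith

end IsArgmin

/-! ### Singular values -/

namespace LinearMap

variable {E F : Type*} [NormedAddCommGroup E] [InnerProductSpace ℝ E] [FiniteDimensional ℝ E]
  [NormedAddCommGroup F] [InnerProductSpace ℝ F] [FiniteDimensional ℝ F] (T : E →ₗ[ℝ] F)

theorem norm_sq_apply_eq_sum_singularValues (x : E) :
    ‖T x‖ ^ 2 = ∑ i : Fin (Module.finrank ℝ E), T.singularValues i ^ 2 *
      inner ℝ (T.isSymmetric_adjoint_comp_self.eigenvectorBasis rfl i) x ^ 2 := by
  set b := T.isSymmetric_adjoint_comp_self.eigenvectorBasis rfl with hb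
  have h1 : ‖T x‖ ^ 2 = inner ℝ ((T.adjoint ∘ₗ T) x) x := by
    rw [comp_apply, adjoint_inner_left, real_inner_self_eq_norm_sq]
  rw [h1, ← b.sum_inner_mul_inner]
  refine Finset.sum_congr rfl fun i _ => ?_
  rw [T.isSymmetric_adjoint_comp_self x (b i), hb,
    T.isSymmetric_adjoint_comp_self.apply_eigenvectorBasis rfl i, inner_smul_right,
    T.sq_singularValues_fin rfl i, real_inner_comm x]
  simp only [RCLike.ofReal_real_eq_id, id_eq]
  ring

theorem inner_eigenvectorBasis_eq_zero {x : E} (hx : x ∈ (ker T)ᗮ)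
    (i : Fin (Module.finrank ℝ E)) (hi : T.singularValues i = 0) :
    inner ℝ (T.isSymmetric_adjoint_comp_self.eigenvectorBasis rfl i) x = 0 := by
  refine hx _ (mem_ker.2 ?_)
  have h := T.isSymmetric_adjoint_comp_self.apply_eigenvectorBasis rfl i
  rw [← T.sq_singularValues_fin rfl i, hi] at h
  rw [← norm_eq_zero, ← sq_eq_zero_iff, ← real_inner_self_eq_norm_sq, ← adjoint_inner_left,
    ← comp_apply, h]
  simp

end LinearMap

namespace LPData

variable {m n : ℕ} (P : LPData m n)

/-! ### The linear program as a pair of affine sets -/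

/-- The kernel of `A`, the space of directions of `V_p`. -/
noncomputable def kerA : Submodule ℝ (EuclideanSpace ℝ (Fin n)) :=
  LinearMap.ker (Matrix.toEuclideanLin P.A)

theorem mem_kerA {x : EuclideanSpace ℝ (Fin n)} : x ∈ P.kerA ↔ P.mulA x = 0 := LinearMap.mem_ker

theorem mulA_add (x y : EuclideanSpace ℝ (Fin n)) : P.mulA (x + y) = P.mulA x + P.mulA y :=
  map_add _ _ _

theorem mulA_sub (x y : EuclideanSpace ℝ (Fin n)) : P.mulA (x - y) = P.mulA x - P.mulA y :=
  map_sub _ _ _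

theorem mulA_smul (t : ℝ) (x : EuclideanSpace ℝ (Fin n)) : P.mulA (t • x) = t • P.mulA x :=
  map_smul _ _ _

theorem mulAT_add (x y : EuclideanSpace ℝ (Fin m)) : P.mulAT (x + y) = P.mulAT x + P.mulAT y :=
  map_add _ _ _

theorem mulAT_sub (x y : EuclideanSpace ℝ (Fin m)) : P.mulAT (x - y) = P.mulAT x - P.mulAT y :=
  map_sub _ _ _

theorem mulAT_smul (t : ℝ) (x : EuclideanSpace ℝ (Fin m)) : P.mulAT (t • x) = t • P.mulAT x :=
  map_smul _ _ _

theorem mulAT_zero : P.mulAT 0 = 0 := map_zero _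

theorem mulAT_eq_adjoint (y : EuclideanSpace ℝ (Fin m)) :
    P.mulAT y = LinearMap.adjoint (Matrix.toEuclideanLin P.A) y := by
  rw [← Matrix.toEuclideanLin_conjTranspose_eq_adjoint,
    Matrix.conjTranspose_eq_transpose_of_trivial]
  rfl

theorem inner_mulAT_right (x : EuclideanSpace ℝ (Fin n)) (y : EuclideanSpace ℝ (Fin m)) :
    inner ℝ x (P.mulAT y) = inner ℝ (P.mulA x) y := by
  rw [mulAT_eq_adjoint, LinearMap.adjoint_inner_right]
  rfl

theorem mem_orthogonal_kerA {x : EuclideanSpace ℝ (Fin n)} :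
    x ∈ P.kerAᗮ ↔ ∃ y, P.mulAT y = x := by
  rw [kerA, LinearMap.orthogonal_ker, LinearMap.mem_range]
  simp only [mulAT_eq_adjoint]

theorem mulAT_mem_orthogonal (y : EuclideanSpace ℝ (Fin m)) : P.mulAT y ∈ P.kerAᗮ :=
  P.mem_orthogonal_kerA.2 ⟨y, rfl⟩

theorem q_mem_orthogonal : P.q ∈ P.kerAᗮ := P.mulAT_mem_orthogonal _

theorem inner_q_c (hc : P.mulA P.c = 0) : inner ℝ P.q P.c = 0 := by
  rw [real_inner_comm]
  exact P.q_mem_orthogonal _ (P.mem_kerA.2 hc)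

/-- The vector `q` solves `A x = b` as soon as this system is solvable: `(A Aᵀ)(A Aᵀ)†` acts as
the identity on the range of `A`. -/
theorem mulA_q {x : EuclideanSpace ℝ (Fin n)} (hx : P.mulA x = P.b) : P.mulA P.q = P.b := by
  have hB : (P.A * P.Aᵀ).IsHermitian := by
    simpa using Matrix.isHermitian_mul_conjTranspose_self P.A
  obtain ⟨h1, -, -, -⟩ := symPinv_penrose hB
  set X := symPinv hB with hX
  have hA : P.A * P.Aᵀ * X * P.A = P.A := by
    rw [← sub_eq_zero, ← Matrix.self_mul_conjTranspose_eq_zero,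
      Matrix.conjTranspose_eq_transpose_of_trivial, Matrix.transpose_sub, Matrix.mul_sub,
      Matrix.sub_mul, Matrix.sub_mul]
    have h2 : P.A * P.Aᵀ * X * P.A * P.Aᵀ = P.A * P.Aᵀ := by rw [Matrix.mul_assoc _ P.A, h1]
    rw [h2, sub_self, sub_zero, Matrix.transpose_mul, ← Matrix.mul_assoc, ← Matrix.mul_assoc, h2,
      sub_self]
  have h3 : P.mulA P.q = Matrix.toEuclideanLin (P.A * P.Aᵀ * X * P.A) x := by
    unfold q
    rw [← hx]
    unfold mulA mulAT
    simp only [Matrix.toLpLin_apply, Matrix.mulVec_mulVec, Matrix.mul_assoc]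
    rfl
  rw [h3, hA]
  exact hx

theorem Vp_eq (hq : P.mulA P.q = P.b) : P.Vp = affineSet P.q P.kerA := by
  ext x
  change P.mulA x = P.b ↔ x - P.q ∈ P.kerA
  rw [mem_kerA, mulA_sub, hq, sub_eq_zero]

theorem Vd_eq : P.Vd = affineSet P.c P.kerAᗮ := by
  ext s
  change (∃ y, s = P.c + P.mulAT y) ↔ s - P.c ∈ P.kerAᗮ
  rw [mem_orthogonal_kerA]
  simp only [eq_sub_iff_add_eq', eq_comm]

theorem slack_mem_Vd (y : EuclideanSpace ℝ (Fin m)) : P.slack y ∈ P.Vd :=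
  ⟨-y, by rw [slack, ← zero_sub y, mulAT_sub, mulAT_zero]; abel⟩

theorem infDist_zero_affineSet {x₀ : EuclideanSpace ℝ (Fin n)}
    {U : Submodule ℝ (EuclideanSpace ℝ (Fin n))} (hx₀ : x₀ ∈ Uᗮ) :
    Metric.infDist 0 (affineSet x₀ U) = ‖x₀‖ := by
  have hmem : x₀ ∈ affineSet x₀ U := by
    change x₀ - x₀ ∈ U
    rw [sub_self]
    exact zero_mem _
  apply le_antisymm
  · simpa using Metric.infDist_le_dist_of_mem (x := 0) hmem
  · refine (Metric.le_infDist ⟨x₀, hmem⟩).2 fun x hx => ?_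
    have h : inner ℝ (x - x₀) x₀ = 0 := hx₀ _ hx
    rw [dist_zero_left]
    rw [inner_sub_left, real_inner_self_eq_norm_sq] at h
    have h2 := real_inner_le_norm x x₀
    by_contra! hlt
    nlinarith [norm_nonneg x, norm_nonneg x₀, mul_pos (lt_of_le_of_lt (norm_nonneg _) hlt)
      (sub_pos.2 hlt)]

/-- Primal and dual of the linear program as minimization problems over complementary affine sets.
Strong duality appears as the equality of the optimal values up to sign: the Farkas multiplier of
the objective at a primal optimal point is a complementary dual feasible slack. -/
theorem exists_isArgmin (hc : P.mulA P.c = 0) (hopt : P.Xopt.Nonempty)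
    (hprimal : (P.Fp \ P.Xopt).Nonempty) (hdual : (P.Fd \ P.Sopt).Nonempty) :
    ∃ f : ℝ, P.mulA P.q = P.b ∧ IsArgmin P.q P.kerA P.c f P.Hp P.Xopt ∧
      IsArgmin P.c P.kerAᗮ P.q (-f) P.Hd P.Sopt := by
  obtain ⟨x, hx⟩ := hopt
  have hq : P.mulA P.q = P.b := P.mulA_q hx.1.1
  have hVp := P.Vp_eq hq
  have hVd := P.Vd_eq
  have hFp : P.Fp = affineSet P.q P.kerA ∩ orthant n := by rw [Fp, hVp]
  have hFd : P.Fd = affineSet P.c P.kerAᗮ ∩ orthant n := by rw [Fd, hVd]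
  have hcU : P.c ∈ P.kerA := P.mem_kerA.2 hc
  have hqc := P.inner_q_c hc
  -- the objective of a dual feasible slack, in terms of the primal optimal point
  have hobj : ∀ s ∈ P.Vd, inner ℝ P.q s = -inner ℝ P.c x + inner ℝ x s := by
    intro s hs
    rw [hVd] at hs
    have hxq : x - P.q ∈ P.kerA := by
      have := hx.1.1
      rw [hVp] at this
      exact this
    have h := hs _ hxq
    rw [inner_sub_left, inner_sub_right, inner_sub_right, hqc, real_inner_comm P.c x] at h
    linarith
  obtain ⟨C, -, hC⟩ := exists_bounded_farkas P.kerA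
  obtain ⟨s, hs, hsI, hcs, -⟩ := hC {i | x i = 0} P.c hcU (fun d hd hdI => by
    obtain ⟨t, ht, -, htm⟩ := exists_pos_add_smul_mem_orthant hx.1.2 hdI
    have hmem : x + t • d ∈ P.Fp := by
      refine ⟨?_, htm⟩
      rw [hVp]
      exact add_mem_affineSet (hVp ▸ hx.1.1) (P.kerA.smul_mem t hd)
    have h : inner ℝ P.c x ≤ inner ℝ P.c (x + t • d) := hx.2 hmem
    rw [inner_add_right, inner_smul_right, le_add_iff_nonneg_right] at h
    exact nonneg_of_mul_nonneg_right h ht)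
  have hsV : s ∈ P.Vd := by
    rw [hVd]
    change s - P.c ∈ P.kerAᗮ
    rw [← neg_sub]
    exact P.kerAᗮ.neg_mem hcs
  have hxs : inner ℝ x s = 0 := by
    rw [PiLp.inner_apply]
    refine Finset.sum_eq_zero fun i _ => ?_
    by_cases hi : x i = 0
    · simp [hi]
    · simp [hsI i hi]
  have hmaxle : ∀ s' ∈ P.Fd, -inner ℝ P.c x ≤ inner ℝ P.q s' := by
    intro s' hs'
    rw [hobj s' hs'.1]
    linarith [inner_nonneg_of_mem_orthant hx.1.2 hs'.2]
  have hSiff : ∀ s', s' ∈ P.Sopt ↔ s' ∈ P.Fd ∧ inner ℝ P.q s' = -inner ℝ P.c x := by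
    intro s'
    constructor
    · rintro ⟨h1, h2⟩
      refine ⟨h1, le_antisymm ?_ (hmaxle s' h1)⟩
      have h3 : inner ℝ P.q (P.c - s) ≤ inner ℝ P.q (P.c - s') := h2 ⟨hsV, hs⟩
      rw [inner_sub_right, inner_sub_right, hobj s hsV, hxs] at h3
      linarith
    · rintro ⟨h1, h2⟩
      refine ⟨h1, fun s'' hs'' => ?_⟩
      change inner ℝ P.q (P.c - s'') ≤ inner ℝ P.q (P.c - s')
      rw [inner_sub_right, inner_sub_right, h2]
      linarith [hmaxle s'' hs'']
  have hXiff : ∀ x', x' ∈ P.Xopt ↔ x' ∈ P.Fp ∧ inner ℝ P.c x' = inner ℝ P.c x := by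
    intro x'
    constructor
    · rintro ⟨h1, h2⟩
      exact ⟨h1, le_antisymm (h2 hx.1) (hx.2 h1)⟩
    · rintro ⟨h1, h2⟩
      refine ⟨h1, fun x'' hx'' => ?_⟩
      change inner ℝ P.c x' ≤ inner ℝ P.c x''
      rw [h2]
      exact hx.2 hx''
  have hsS : s ∈ P.Sopt := (hSiff s).2 ⟨⟨hsV, hs⟩, by rw [hobj s hsV, hxs, add_zero]⟩
  refine ⟨inner ℝ P.c x, hq, ⟨hcU, ?_, ?_, ?_, ⟨x, hx⟩, ?_⟩, ⟨P.q_mem_orthogonal, ?_, ?_, ?_,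
    ⟨s, hsS⟩, ?_⟩⟩
  · rw [← hFp]; exact hXiff
  · rw [← hFp]; exact fun x' hx' => hx.2 hx'
  · intro x'
    constructor
    · rintro ⟨x'', h1, h2⟩
      rw [h2, ((hXiff x'').1 h1).2]
    · exact fun h => ⟨x, hx, h⟩
  · rw [← hFp]; exact hprimal
  · rw [← hFd]; exact hSiff
  · rw [← hFd]; exact hmaxle
  · intro s'
    constructor
    · rintro ⟨s'', h1, h2⟩
      rw [inner_sub_right, inner_sub_right, ((hSiff s'').1 h1).2] at h2
      linarith
    · intro h
      refine ⟨s, hsS, ?_⟩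
      rw [inner_sub_right, inner_sub_right, ((hSiff s).1 hsS).2, h]
  · rw [← hFd]; exact hdual

/-! ### The extreme singular values of `A` -/

theorem finite_posSingularValues : P.posSingularValues.Finite := by
  refine ((Matrix.toEuclideanLin P.A).singularValues.support.image
    (Matrix.toEuclideanLin P.A).singularValues).finite_toSet.subset ?_
  rintro t ⟨ht, i, rfl⟩
  simp only [Finset.coe_image]
  exact ⟨i, by simpa using Finsupp.mem_support_iff.2 ht, rfl⟩

theorem lamMin_le {i : ℕ} (hi : (Matrix.toEuclideanLin P.A).singularValues i ≠ 0) :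
    P.lamMin ≤ (Matrix.toEuclideanLin P.A).singularValues i :=
  csInf_le P.finite_posSingularValues.bddBelow ⟨hi, i, rfl⟩

theorem le_lamMax {i : ℕ} (hi : (Matrix.toEuclideanLin P.A).singularValues i ≠ 0) :
    (Matrix.toEuclideanLin P.A).singularValues i ≤ P.lamMax :=
  le_csSup P.finite_posSingularValues.bddAbove ⟨hi, i, rfl⟩

theorem posSingularValues_nonempty {x : EuclideanSpace ℝ (Fin n)} (hx : P.mulA x ≠ 0) :
    P.posSingularValues.Nonempty := by
  have h : (Matrix.toEuclideanLin P.A).singularValues ≠ 0 := by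
    rw [Ne, LinearMap.singularValues_eq_zero_iff]
    intro h
    exact hx (by rw [mulA, h, LinearMap.zero_apply])
  obtain ⟨i, hi⟩ := Finsupp.ne_iff.1 h
  exact ⟨_, hi, i, rfl⟩

theorem lamMin_pos {x : EuclideanSpace ℝ (Fin n)} (hx : P.mulA x ≠ 0) : 0 < P.lamMin := by
  obtain ⟨h0, i, hi⟩ := (P.posSingularValues_nonempty hx).csInf_mem P.finite_posSingularValues
  rw [lamMin]
  refine lt_of_le_of_ne ?_ h0.symm
  rw [← hi]
  exact LinearMap.singularValues_nonneg _ _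

theorem lamMin_le_lamMax {x : EuclideanSpace ℝ (Fin n)} (hx : P.mulA x ≠ 0) :
    P.lamMin ≤ P.lamMax :=
  csInf_le_csSup (P.posSingularValues_nonempty hx) P.finite_posSingularValues.bddBelow
    P.finite_posSingularValues.bddAbove

theorem lamMax_nonneg : 0 ≤ P.lamMax :=
  Real.sSup_nonneg (by rintro _ ⟨-, i, rfl⟩; exact LinearMap.singularValues_nonneg _ _)

theorem lamMin_nonneg : 0 ≤ P.lamMin :=
  Real.sInf_nonneg (by rintro _ ⟨-, i, rfl⟩; exact LinearMap.singularValues_nonneg _ _)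

theorem norm_mulA_le (x : EuclideanSpace ℝ (Fin n)) : ‖P.mulA x‖ ≤ P.lamMax * ‖x‖ := by
  refine le_of_sq_le_sq ?_ (mul_nonneg P.lamMax_nonneg (norm_nonneg _))
  set T := Matrix.toEuclideanLin P.A with hT
  set b := T.isSymmetric_adjoint_comp_self.eigenvectorBasis rfl with hb
  rw [mul_pow, ← b.sum_sq_norm_inner_right x, Finset.mul_sum]
  refine (T.norm_sq_apply_eq_sum_singularValues x).le.trans (Finset.sum_le_sum fun i _ => ?_)
  rw [Real.norm_eq_abs, sq_abs]
  refine mul_le_mul_of_nonneg_right (pow_le_pow_left₀ (T.singularValues_nonneg i) ?_ 2)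
    (sq_nonneg _)
  by_cases h : T.singularValues i = 0
  · rw [h]; exact P.lamMax_nonneg
  · exact P.le_lamMax h

theorem lamMin_mul_norm_le {x : EuclideanSpace ℝ (Fin n)} (hx : x ∈ P.kerAᗮ) :
    P.lamMin * ‖x‖ ≤ ‖P.mulA x‖ := by
  refine le_of_sq_le_sq ?_ (norm_nonneg _)
  set T := Matrix.toEuclideanLin P.A with hT
  set b := T.isSymmetric_adjoint_comp_self.eigenvectorBasis rfl with hb
  rw [mul_pow, ← b.sum_sq_norm_inner_right x, Finset.mul_sum]
  refine (Finset.sum_le_sum fun i _ => ?_).trans (T.norm_sq_apply_eq_sum_singularValues x).ge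
  rw [Real.norm_eq_abs, sq_abs]
  by_cases h : T.singularValues i = 0
  · have h0 := T.inner_eigenvectorBasis_eq_zero hx i h
    rw [← hb] at h0
    rw [← hb, h0]
    simp
  · exact mul_le_mul_of_nonneg_right (pow_le_pow_left₀ P.lamMin_nonneg (P.lamMin_le h) 2)
      (sq_nonneg _)

theorem lamMin_mul_norm_mulA_le (x : EuclideanSpace ℝ (Fin n)) :
    P.lamMin * ‖P.mulA x‖ ≤ ‖P.mulAT (P.mulA x)‖ := by
  -- only the component of `x` orthogonal to the kernel matters
  wlog hx : x ∈ P.kerAᗮ generalizing x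
  · have h := this (x - P.kerA.starProjection x) (Submodule.sub_starProjection_mem_orthogonal x)
    rwa [mulA_sub, P.mem_kerA.1 (Submodule.starProjection_apply_mem _ x), sub_zero] at h
  have h1 := P.lamMin_mul_norm_le hx
  have h2 : ‖P.mulA x‖ ^ 2 ≤ ‖x‖ * ‖P.mulAT (P.mulA x)‖ := by
    rw [← real_inner_self_eq_norm_sq, ← inner_mulAT_right]
    exact real_inner_le_norm _ _
  rcases (norm_nonneg (P.mulA x)).eq_or_lt with h0 | h0
  · rw [← h0, mul_zero]
    exact norm_nonneg _
  · refine le_of_mul_le_mul_right ?_ h0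
    calc P.lamMin * ‖P.mulA x‖ * ‖P.mulA x‖ = P.lamMin * ‖P.mulA x‖ ^ 2 := by ring
      _ ≤ P.lamMin * (‖x‖ * ‖P.mulAT (P.mulA x)‖) := by
        gcongr
        exact P.lamMin_nonneg
      _ = P.lamMin * ‖x‖ * ‖P.mulAT (P.mulA x)‖ := by ring
      _ ≤ ‖P.mulA x‖ * ‖P.mulAT (P.mulA x)‖ := by gcongr
      _ = _ := by ring

end LPData

/-! ### The `M`-norm -/

/-- The space of primal-dual pairs `(x, y)`. -/
abbrev PrimalDual (m n : ℕ) : Type := EuclideanSpace ℝ (Fin n) × EuclideanSpace ℝ (Fin m)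

namespace LPData

variable {m n : ℕ} (P : LPData m n)

/-- The bilinear form `wᵀ M z` that induces `normM`. -/
noncomputable def innerM (τ σ : ℝ) : LinearMap.BilinForm ℝ (PrimalDual m n) :=
  LinearMap.mk₂ ℝ (fun w z => inner ℝ w.1 ((1 / τ) • z.1 + P.mulAT z.2) +
      inner ℝ w.2 (P.mulA z.1 + (1 / σ) • z.2))
    (fun a b z => by
      simp only [Prod.fst_add, Prod.snd_add, inner_add_left]; ring)
    (fun r a z => by
      simp only [Prod.smul_fst, Prod.smul_snd, real_inner_smul_left, smul_eq_mul]; ring)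
    (fun w a b => by
      simp only [Prod.fst_add, Prod.snd_add, mulA_add, mulAT_add, inner_add_right, smul_add]; ring)
    (fun r w a => by
      simp only [Prod.smul_fst, Prod.smul_snd, mulA_smul, mulAT_smul, inner_add_right,
        real_inner_smul_right, smul_eq_mul]; ring)

theorem innerM_apply (τ σ : ℝ) (w z : PrimalDual m n) : P.innerM τ σ w z =
    inner ℝ w.1 ((1 / τ) • z.1 + P.mulAT z.2) + inner ℝ w.2 (P.mulA z.1 + (1 / σ) • z.2) := rfl

theorem innerM_isSymm (τ σ : ℝ) : (P.innerM τ σ).IsSymm where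
  eq w z := by
    simp only [innerM_apply, inner_add_right, real_inner_smul_right, inner_mulAT_right]
    rw [real_inner_comm z.1 w.1, real_inner_comm z.2 w.2, real_inner_comm (P.mulA z.1) w.2,
      real_inner_comm (P.mulA w.1) z.2]
    ring

theorem normM_eq_sqrt (τ σ : ℝ) (z : PrimalDual m n) :
    P.normM τ σ z = Real.sqrt (P.innerM τ σ z z) := rfl

theorem normM_nonneg (τ σ : ℝ) (z : PrimalDual m n) : 0 ≤ P.normM τ σ z := Real.sqrt_nonneg _

/-- Step-sizes for which the coupling term of `M` is dominated by its diagonal. -/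
structure IsStepSize (τ σ : ℝ) : Prop where
  tau_pos : 0 < τ
  sigma_pos : 0 < σ
  le_one : P.lamMax * (√τ * √σ) ≤ 1

namespace IsStepSize

variable {P} {τ σ : ℝ}

theorem abs_inner_le (h : P.IsStepSize τ σ) (z : PrimalDual m n) :
    |inner ℝ (P.mulA z.1) z.2| ≤ ‖z.1‖ / √τ * (‖z.2‖ / √σ) := by
  have ht : 0 < √τ := Real.sqrt_pos.2 h.tau_pos
  have hs : 0 < √σ := Real.sqrt_pos.2 h.sigma_pos
  rw [div_mul_div_comm, le_div_iff₀ (mul_pos ht hs)]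
  calc |inner ℝ (P.mulA z.1) z.2| * (√τ * √σ) ≤ P.lamMax * ‖z.1‖ * ‖z.2‖ * (√τ * √σ) := by
        gcongr
        exact (abs_real_inner_le_norm _ _).trans
          (mul_le_mul_of_nonneg_right (P.norm_mulA_le _) (norm_nonneg _))
    _ = P.lamMax * (√τ * √σ) * (‖z.1‖ * ‖z.2‖) := by ring
    _ ≤ 1 * (‖z.1‖ * ‖z.2‖) := by gcongr; exact h.le_one
    _ = _ := one_mul _

theorem innerM_self (h : P.IsStepSize τ σ) (z : PrimalDual m n) :
    P.innerM τ σ z z =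
      (‖z.1‖ / √τ) ^ 2 + 2 * inner ℝ (P.mulA z.1) z.2 + (‖z.2‖ / √σ) ^ 2 := by
  rw [innerM_apply, inner_add_right, inner_add_right, inner_mulAT_right, real_inner_smul_right,
    real_inner_smul_right, real_inner_self_eq_norm_sq, real_inner_self_eq_norm_sq, div_pow, div_pow,
    Real.sq_sqrt h.tau_pos.le, Real.sq_sqrt h.sigma_pos.le, real_inner_comm (P.mulA z.1) z.2]
  ring

theorem innerM_self_nonneg (h : P.IsStepSize τ σ) (z : PrimalDual m n) :
    0 ≤ P.innerM τ σ z z := by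
  rw [h.innerM_self]
  nlinarith [neg_le_of_abs_le (h.abs_inner_le z), sq_nonneg (‖z.1‖ / √τ - ‖z.2‖ / √σ)]

theorem normM_sq (h : P.IsStepSize τ σ) (z : PrimalDual m n) :
    P.normM τ σ z ^ 2 = P.innerM τ σ z z := by
  rw [normM_eq_sqrt, Real.sq_sqrt (h.innerM_self_nonneg z)]

theorem normM_le (h : P.IsStepSize τ σ) (z : PrimalDual m n) :
    P.normM τ σ z ≤ ‖z.1‖ / √τ + ‖z.2‖ / √σ := by
  refine le_of_sq_le_sq ?_ (by positivity)
  rw [h.normM_sq, h.innerM_self]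
  nlinarith [le_of_abs_le (h.abs_inner_le z)]

theorem normM_add_le (h : P.IsStepSize τ σ) (w z : PrimalDual m n) :
    P.normM τ σ (w + z) ≤ P.normM τ σ w + P.normM τ σ z := by
  have hsymm : P.innerM τ σ z w = P.innerM τ σ w z := (P.innerM_isSymm τ σ).eq z w
  have hcs := LinearMap.BilinForm.apply_mul_apply_le_of_forall_zero_le (P.innerM τ σ)
    h.innerM_self_nonneg w z
  rw [← h.normM_sq, ← h.normM_sq, ← mul_pow, hsymm, ← sq] at hcs
  have h1 := le_of_sq_le_sq hcs (mul_nonneg (P.normM_nonneg τ σ w) (P.normM_nonneg τ σ z))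
  refine le_of_sq_le_sq ?_ (add_nonneg (P.normM_nonneg τ σ w) (P.normM_nonneg τ σ z))
  rw [h.normM_sq, add_sq, h.normM_sq, h.normM_sq]
  simp only [map_add, LinearMap.add_apply]
  linarith

theorem normM_smul (h : P.IsStepSize τ σ) {t : ℝ} (ht : 0 ≤ t) (z : PrimalDual m n) :
    P.normM τ σ (t • z) = t * P.normM τ σ z := by
  refine (pow_left_inj₀ (P.normM_nonneg τ σ _)
    (mul_nonneg ht (P.normM_nonneg τ σ z)) two_ne_zero).1 ?_
  rw [mul_pow, h.normM_sq, h.normM_sq]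
  simp only [map_smul, LinearMap.smul_apply, smul_eq_mul]
  ring

end IsStepSize

theorem normM_neg (τ σ : ℝ) (z : PrimalDual m n) : P.normM τ σ (-z) = P.normM τ σ z := by
  rw [normM_eq_sqrt, normM_eq_sqrt]
  simp only [map_neg, LinearMap.neg_apply, neg_neg]

theorem normM_sub_comm (τ σ : ℝ) (w z : PrimalDual m n) :
    P.normM τ σ (w - z) = P.normM τ σ (z - w) := by
  rw [← normM_neg, neg_sub]

theorem normM_zero (τ σ : ℝ) : P.normM τ σ (0 : PrimalDual m n) = 0 := by
  rw [normM_eq_sqrt, map_zero, Real.sqrt_zero]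

/-! ### PDHG steps, their averages and the duality gap -/

/-- The duality gap `L(x, ŷ) - L(x̂, y)` of `z = (x, y)` against `w = (x̂, ŷ)`. -/
noncomputable def gap (z w : PrimalDual m n) : ℝ := P.lagrangian z.1 w.2 - P.lagrangian w.1 z.2

/-- A pair against which every pair with nonnegative primal part has a nonnegative gap. -/
def IsSaddle (z : PrimalDual m n) : Prop := ∀ w : PrimalDual m n, w.1 ∈ orthant n → 0 ≤ P.gap w z

theorem inner_sub_projOrthant_nonpos (v : EuclideanSpace ℝ (Fin n))
    {u : EuclideanSpace ℝ (Fin n)} (hu : u ∈ orthant n) :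
    inner ℝ (v - projOrthant v) (u - projOrthant v) ≤ 0 := by
  rw [PiLp.inner_apply]
  refine Finset.sum_nonpos fun i _ => ?_
  simp only [PiLp.sub_apply, projOrthant_apply, RCLike.inner_apply, conj_trivial]
  rcases le_total (v i) 0 with h | h
  · rw [max_eq_right h]
    nlinarith [hu i]
  · rw [max_eq_left h]
    simp

/-- A PDHG step is a proximal point step in the `M`-norm. -/
theorem IsStepSize.gap_pdhgStep_le {P : LPData m n} {τ σ : ℝ} (h : P.IsStepSize τ σ)
    (z w : PrimalDual m n) (hw : w.1 ∈ orthant n) :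
    P.gap (P.pdhgStep τ σ z) w ≤
      (P.normM τ σ (w - z) ^ 2 - P.normM τ σ (w - P.pdhgStep τ σ z) ^ 2) / 2 := by
  set z' := P.pdhgStep τ σ z with hz'
  have hx := inner_sub_projOrthant_nonpos (z.1 - τ • (P.c - P.mulAT z.2)) hw
  have hx1 : z'.1 = projOrthant (z.1 - τ • (P.c - P.mulAT z.2)) := rfl
  have hy1 : z'.2 = z.2 + σ • (P.b - P.mulA ((2 : ℝ) • z'.1 - z.1)) := rfl
  rw [← hx1] at hx
  have hprox : P.gap z' w ≤ P.innerM τ σ (z' - w) (z - z') := by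
    have hy2 : (1 / σ) • (z.2 - z'.2) = P.mulA ((2 : ℝ) • z'.1 - z.1) - P.b := by
      rw [hy1, sub_add_cancel_left, ← smul_neg, smul_smul, one_div,
        inv_mul_cancel₀ h.sigma_pos.ne', one_smul, neg_sub]
    have hx2 : inner ℝ (z'.1 - w.1) (P.c - P.mulAT z.2) ≤
        inner ℝ (z'.1 - w.1) ((1 / τ) • (z.1 - z'.1)) := by
      have e : z.1 - τ • (P.c - P.mulAT z.2) - z'.1 =
          τ • ((1 / τ) • (z.1 - z'.1) - (P.c - P.mulAT z.2)) := by
        rw [smul_sub τ ((1 / τ) • (z.1 - z'.1)), smul_smul, mul_one_div_cancel h.tau_pos.ne', one_smul]; abel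
      rw [e, real_inner_smul_left, ← neg_sub z'.1 w.1, inner_neg_right, real_inner_comm] at hx
      have h1 : 0 ≤ inner ℝ (z'.1 - w.1) ((1 / τ) • (z.1 - z'.1) - (P.c - P.mulAT z.2)) := by
        by_contra! h2
        nlinarith [mul_pos h.tau_pos (neg_pos.2 h2)]
      rw [inner_sub_right] at h1
      linarith
    rw [innerM_apply]
    simp only [Prod.fst_sub, Prod.snd_sub]
    rw [hy2, inner_add_right]
    refine le_trans (le_of_eq ?_) (add_le_add_left (add_le_add_left hx2 _) _)
    simp only [gap, lagrangian, mulA_sub, mulA_smul, mulAT_sub, inner_sub_left, inner_sub_right,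
      inner_add_right, inner_mulAT_right, real_inner_smul_right]
    rw [real_inner_comm P.c z'.1, real_inner_comm P.c w.1, real_inner_comm P.b z'.2,
      real_inner_comm P.b w.2, real_inner_comm (P.mulA z'.1) z'.2,
      real_inner_comm (P.mulA z'.1) w.2, real_inner_comm (P.mulA z.1) z'.2,
      real_inner_comm (P.mulA z.1) w.2]
    ring
  have hpolar : P.innerM τ σ (z' - w) (z - z') =
      (P.normM τ σ (w - z) ^ 2 - P.normM τ σ (w - z') ^ 2 - P.normM τ σ (z - z') ^ 2) / 2 := by
    have e : w - z = (w - z') - (z - z') := by abel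
    have e2 : z' - w = -(w - z') := by abel
    have hsymm : P.innerM τ σ (z - z') (w - z') = P.innerM τ σ (w - z') (z - z') :=
      (P.innerM_isSymm τ σ).eq (z - z') (w - z')
    rw [e, e2, h.normM_sq, h.normM_sq, h.normM_sq]
    simp only [map_sub, LinearMap.sub_apply, map_neg, LinearMap.neg_apply] at *
    linarith
  rw [hpolar] at hprox
  nlinarith [sq_nonneg (P.normM τ σ (z - z'))]

/-- The sum of the first `k` PDHG iterates started at `z`. -/
noncomputable def pdhgSum (τ σ : ℝ) (z : PrimalDual m n) (k : ℕ) : PrimalDual m n :=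
  ∑ i ∈ Finset.range k, (P.pdhgStep τ σ)^[i + 1] z

/-- The average of the first `k` PDHG iterates started at `z`. -/
noncomputable def pdhgAvg (τ σ : ℝ) (z : PrimalDual m n) (k : ℕ) : PrimalDual m n :=
  (1 / (k : ℝ)) • P.pdhgSum τ σ z k

theorem pdhgSum_succ (τ σ : ℝ) (z : PrimalDual m n) (k : ℕ) :
    P.pdhgSum τ σ z (k + 1) = P.pdhgSum τ σ z k + (P.pdhgStep τ σ)^[k + 1] z :=
  Finset.sum_range_succ _ _

theorem pdhgStep_mem_orthant (τ σ : ℝ) (z : PrimalDual m n) :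
    (P.pdhgStep τ σ z).1 ∈ orthant n := projOrthant_mem_orthant _

theorem pdhgAvg_mem_orthant (τ σ : ℝ) (z : PrimalDual m n) (k : ℕ) :
    (P.pdhgAvg τ σ z k).1 ∈ orthant n := by
  refine smul_mem_orthant (by positivity) ?_
  induction k with
  | zero => simpa [pdhgSum] using zero_mem_orthant n
  | succ k ih =>
    rw [pdhgSum_succ, Function.iterate_succ_apply']
    exact add_mem_orthant ih (P.pdhgStep_mem_orthant τ σ _)

/-- The part of `P.gap z w` that is linear in `z`. -/
noncomputable def gapLin (w : PrimalDual m n) : PrimalDual m n →ₗ[ℝ] ℝ where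
  toFun z := inner ℝ P.c z.1 - inner ℝ z.1 (P.mulAT w.2) - inner ℝ P.b z.2 +
    inner ℝ w.1 (P.mulAT z.2)
  map_add' a b := by
    simp only [Prod.fst_add, Prod.snd_add, inner_add_left, inner_add_right, mulAT_add]; ring
  map_smul' r a := by
    simp only [Prod.smul_fst, Prod.smul_snd, real_inner_smul_left, real_inner_smul_right,
      mulAT_smul, smul_eq_mul, RingHom.id_apply]; ring

theorem gap_eq_gapLin (z w : PrimalDual m n) :
    P.gap z w = P.gapLin w z + (inner ℝ P.b w.2 - inner ℝ P.c w.1) := by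
  change _ = inner ℝ P.c z.1 - inner ℝ z.1 (P.mulAT w.2) - inner ℝ P.b z.2 +
    inner ℝ w.1 (P.mulAT z.2) + _
  rw [gap, lagrangian, lagrangian]
  ring

/-- The summed form of `gap_pdhgStep_le`: the right-hand sides telescope. -/
theorem IsStepSize.gapLin_pdhgSum_le {P : LPData m n} {τ σ : ℝ} (h : P.IsStepSize τ σ)
    (z w : PrimalDual m n) (hw : w.1 ∈ orthant n) (k : ℕ) :
    P.gapLin w (P.pdhgSum τ σ z k) + k * (inner ℝ P.b w.2 - inner ℝ P.c w.1) ≤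
      (P.normM τ σ (w - z) ^ 2 - P.normM τ σ (w - (P.pdhgStep τ σ)^[k] z) ^ 2) / 2 := by
  induction k with
  | zero => simp [pdhgSum]
  | succ k ih =>
    have h1 := h.gap_pdhgStep_le ((P.pdhgStep τ σ)^[k] z) w hw
    rw [← Function.iterate_succ_apply' (P.pdhgStep τ σ), gap_eq_gapLin] at h1
    rw [pdhgSum_succ, map_add]
    push_cast
    linarith

/-- Averages of PDHG iterates have a duality gap of order `1 / k`. -/
theorem IsStepSize.gap_pdhgAvg_le {P : LPData m n} {τ σ : ℝ} (h : P.IsStepSize τ σ)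
    (z w : PrimalDual m n) (hw : w.1 ∈ orthant n) {k : ℕ} (hk : 1 ≤ k) :
    P.gap (P.pdhgAvg τ σ z k) w ≤ P.normM τ σ (w - z) ^ 2 / (2 * k) := by
  have hk0 : (0 : ℝ) < k := by exact_mod_cast hk
  have h1 := h.gapLin_pdhgSum_le z w hw k
  rw [gap_eq_gapLin, pdhgAvg, map_smul, smul_eq_mul, le_div_iff₀ (by positivity)]
  have e : (1 / (k : ℝ) * P.gapLin w (P.pdhgSum τ σ z k) +
      (inner ℝ P.b w.2 - inner ℝ P.c w.1)) * (2 * k) = 2 * (P.gapLin w (P.pdhgSum τ σ z k) +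
      k * (inner ℝ P.b w.2 - inner ℝ P.c w.1)) := by
    field_simp
  rw [e]
  nlinarith [sq_nonneg (P.normM τ σ (w - (P.pdhgStep τ σ)^[k] z))]

/-- PDHG iterates do not move away from saddle points. -/
theorem IsStepSize.normM_iterate_sub_le {P : LPData m n} {τ σ : ℝ} (h : P.IsStepSize τ σ)
    {w : PrimalDual m n} (hw : w.1 ∈ orthant n) (hs : P.IsSaddle w) (z : PrimalDual m n) (k : ℕ) :
    P.normM τ σ ((P.pdhgStep τ σ)^[k] z - w) ≤ P.normM τ σ (z - w) := by
  induction k with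
  | zero => exact le_rfl
  | succ k ih =>
    refine le_trans ?_ ih
    rw [Function.iterate_succ_apply']
    have h1 := h.gap_pdhgStep_le ((P.pdhgStep τ σ)^[k] z) w hw
    have h2 := hs _ (P.pdhgStep_mem_orthant τ σ ((P.pdhgStep τ σ)^[k] z))
    rw [P.normM_sub_comm τ σ w, P.normM_sub_comm τ σ w] at h1
    exact le_of_sq_le_sq (by linarith) (P.normM_nonneg τ σ _)

theorem IsStepSize.normM_pdhgAvg_sub_le {P : LPData m n} {τ σ : ℝ} (h : P.IsStepSize τ σ)
    {w : PrimalDual m n} (hw : w.1 ∈ orthant n) (hs : P.IsSaddle w) (z : PrimalDual m n) {k : ℕ}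
    (hk : 1 ≤ k) : P.normM τ σ (P.pdhgAvg τ σ z k - w) ≤ P.normM τ σ (z - w) := by
  have hk0 : (0 : ℝ) < k := by exact_mod_cast hk
  have hsum : ∀ j : ℕ, P.normM τ σ (P.pdhgSum τ σ z j - (j : ℝ) • w) ≤
      j * P.normM τ σ (z - w) := by
    intro j
    induction j with
    | zero => simp [pdhgSum, normM_zero]
    | succ j ih =>
      have e : P.pdhgSum τ σ z (j + 1) - ((j + 1 : ℕ) : ℝ) • w =
          (P.pdhgSum τ σ z j - (j : ℝ) • w) + ((P.pdhgStep τ σ)^[j + 1] z - w) := by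
        rw [pdhgSum_succ, Nat.cast_succ, add_smul, one_smul]; abel
      rw [e]
      push_cast
      linarith [h.normM_add_le (P.pdhgSum τ σ z j - (j : ℝ) • w) ((P.pdhgStep τ σ)^[j + 1] z - w),
        h.normM_iterate_sub_le hw hs z (j + 1)]
  have e : P.pdhgAvg τ σ z k - w = (1 / (k : ℝ)) • (P.pdhgSum τ σ z k - (k : ℝ) • w) := by
    rw [pdhgAvg, smul_sub, smul_smul, one_div_mul_cancel hk0.ne', one_smul]
  rw [e, h.normM_smul (by positivity)]
  calc 1 / (k : ℝ) * P.normM τ σ (P.pdhgSum τ σ z k - (k : ℝ) • w)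
      ≤ 1 / (k : ℝ) * (k * P.normM τ σ (z - w)) := by gcongr; exact hsum k
    _ = _ := by field_simp

/-! ### The normalized duality gap -/

theorem IsStepSize.gap_le_of_average {P : LPData m n} {τ σ : ℝ} (h : P.IsStepSize τ σ)
    {z z₀ : PrimalDual m n} {k : ℕ} (hz : ∀ w : PrimalDual m n, w.1 ∈ orthant n →
      P.gap z w ≤ P.normM τ σ (w - z₀) ^ 2 / (2 * k)) {r : ℝ} (w : PrimalDual m n)
    (hw : w.1 ∈ orthant n) (hwr : P.normM τ σ (w - z) ≤ r) :
    P.gap z w ≤ (r + P.normM τ σ (z - z₀)) ^ 2 / (2 * k) := by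
  refine (hz w hw).trans ?_
  have e : w - z₀ = (w - z) + (z - z₀) := by abel
  have h1 := h.normM_add_le (w - z) (z - z₀)
  rw [← e] at h1
  have h2 := P.normM_nonneg τ σ (w - z₀)
  gcongr
  linarith

/-- The normalized duality gap is determined by the values of the gap on the ball, which are
bounded for averages of PDHG iterates. -/
theorem IsStepSize.gap_le_mul_normGap {P : LPData m n} {τ σ : ℝ} (h : P.IsStepSize τ σ)
    {z z₀ : PrimalDual m n} {k : ℕ} (hz : ∀ w : PrimalDual m n, w.1 ∈ orthant n →
      P.gap z w ≤ P.normM τ σ (w - z₀) ^ 2 / (2 * k)) {r : ℝ} (hr : 0 < r) (w : PrimalDual m n)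
    (hw : w.1 ∈ orthant n) (hwr : P.normM τ σ (w - z) ≤ r) :
    P.gap z w ≤ r * P.normGap τ σ r z := by
  rw [normGap, ← mul_assoc, mul_one_div_cancel hr.ne', one_mul]
  refine le_csSup ⟨(r + P.normM τ σ (z - z₀)) ^ 2 / (2 * k), ?_⟩ ⟨w, ⟨hw, hwr⟩, rfl⟩
  rintro _ ⟨v, ⟨hv, hvr⟩, rfl⟩
  exact h.gap_le_of_average hz v hv hvr

/-- In the ball around `z` of radius `‖z - z₀‖_M` the distance to `z₀` at most doubles the radius.
For radius zero both sides vanish, since `1 / 0 = 0` in `normGap`. -/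
theorem IsStepSize.normGap_le {P : LPData m n} {τ σ : ℝ} (h : P.IsStepSize τ σ)
    {z z₀ : PrimalDual m n} {k : ℕ} (hz : ∀ w : PrimalDual m n, w.1 ∈ orthant n →
      P.gap z w ≤ P.normM τ σ (w - z₀) ^ 2 / (2 * k)) :
    P.normGap τ σ (P.normM τ σ (z - z₀)) z ≤ 2 * P.normM τ σ (z - z₀) / k := by
  set r := P.normM τ σ (z - z₀) with hr
  have hr0 : 0 ≤ r := P.normM_nonneg τ σ _
  rcases hr0.eq_or_lt with h0 | h0
  · rw [normGap, ← h0]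
    simp
  · rw [normGap, one_div, ← div_eq_inv_mul, div_le_iff₀ h0]
    refine Real.sSup_le ?_ (by positivity)
    rintro _ ⟨v, ⟨hv, hvr⟩, rfl⟩
    refine (h.gap_le_of_average hz v hv hvr).trans_eq ?_
    rw [← hr, ← two_mul]
    rcases eq_or_ne (k : ℝ) 0 with hk | hk
    · simp [hk]
    · field_simp

theorem normGap_nonneg (P : LPData m n) (τ σ : ℝ) {r : ℝ} (hr : 0 ≤ r) {z : PrimalDual m n}
    (hz : z.1 ∈ orthant n) : 0 ≤ P.normGap τ σ r z := by
  refine mul_nonneg (by positivity) (Real.sSup_nonneg' ⟨0, ⟨z, ⟨hz, ?_⟩, ?_⟩, le_rfl⟩)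
  · rw [sub_self, normM_zero]
    exact hr
  · exact sub_self _

end LPData

/-! ### From the normalized duality gap to the distance to the optimal sets -/

namespace LPData

variable {m n : ℕ} {P : LPData m n}

/-- Primal and dual in the form of two argmin problems over complementary affine sets, with common
optimal value `f`. -/
structure HasOptimalValue (P : LPData m n) (f : ℝ) : Prop where
  mulA_c : P.mulA P.c = 0
  mulA_q : P.mulA P.q = P.b
  primal : IsArgmin P.q P.kerA P.c f P.Hp P.Xopt
  dual : IsArgmin P.c P.kerAᗮ P.q (-f) P.Hd P.Sopt

/-- The weights `α = 1 / √τ` and `γ = 1 / (λ_min √σ)` of the primal and the dual distance, for the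
step-sizes of the theorem. The last two fields record what this choice of `τ` and `σ` achieves. -/
structure IsScaling (P : LPData m n) (τ σ α γ : ℝ) : Prop extends P.IsStepSize τ σ where
  lamMin_pos : 0 < P.lamMin
  alpha_pos : 0 < α
  gamma_pos : 0 < γ
  alpha_mul : α * √τ = 1
  gamma_mul : γ * (P.lamMin * √σ) = 1
  mul_eq : α * γ = 2 * P.kappa
  balance : γ * ‖P.c‖ = α * ‖P.q‖

theorem exists_isScaling (hq : P.mulA P.q ≠ 0) (hc0 : P.c ≠ 0) {τ σ : ℝ}
    (hτ : τ = ‖P.q‖ / (2 * P.kappa * ‖P.c‖))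
    (hσ : σ = ‖P.c‖ / (2 * ‖P.q‖ * P.lamMax * P.lamMin)) :
    ∃ α γ : ℝ, P.IsScaling τ σ α γ := by
  have hm := P.lamMin_pos hq
  have hM : 0 < P.lamMax := hm.trans_le (P.lamMin_le_lamMax hq)
  have hκ : 0 < P.kappa := div_pos hM hm
  have hnc : 0 < ‖P.c‖ := norm_pos_iff.2 hc0
  have hnq : 0 < ‖P.q‖ := norm_pos_iff.2 fun h => hq (by rw [h]; exact map_zero _)
  have hτ0 : 0 < τ := by rw [hτ]; positivity
  have hσ0 : 0 < σ := by rw [hσ]; positivity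
  have ht : 0 < √τ := Real.sqrt_pos.2 hτ0
  have hs : 0 < √σ := Real.sqrt_pos.2 hσ0
  have ht2 : √τ ^ 2 = ‖P.q‖ / (2 * P.kappa * ‖P.c‖) := by rw [Real.sq_sqrt hτ0.le, hτ]
  have hs2 : √σ ^ 2 = ‖P.c‖ / (2 * ‖P.q‖ * P.lamMax * P.lamMin) := by rw [Real.sq_sqrt hσ0.le, hσ]
  have hprod : 2 * P.kappa * (√τ * (P.lamMin * √σ)) = 1 := by
    refine (pow_left_inj₀ (by positivity) zero_le_one two_ne_zero).1 ?_
    simp only [mul_pow]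
    rw [ht2, hs2, kappa]
    field_simp
  have hratio : √τ * ‖P.c‖ = P.lamMin * √σ * ‖P.q‖ := by
    refine (pow_left_inj₀ (by positivity) (by positivity) two_ne_zero).1 ?_
    rw [mul_pow, mul_pow, mul_pow _ (√σ), ht2, hs2, kappa]
    field_simp
  refine ⟨1 / √τ, 1 / (P.lamMin * √σ), ⟨hτ0, hσ0, ?_⟩, hm, by positivity, by positivity, ?_, ?_, ?_,
    ?_⟩
  · have : P.lamMax = P.kappa * P.lamMin := by rw [kappa]; field_simp
    rw [this]
    nlinarith
  · field_simp
  · field_simp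
  · field_simp
    linarith
  · field_simp
    linarith

/-- Pairs of optimal solutions are saddle points. -/
theorem HasOptimalValue.isSaddle {f : ℝ} (hf : P.HasOptimalValue f) {z : PrimalDual m n}
    (hx : z.1 ∈ P.Xopt) (hs : P.slack z.2 ∈ P.Sopt) : P.IsSaddle z := by
  intro w hw
  have h1 := (hf.primal.mem_iff _).1 hx
  have h2 := (hf.dual.mem_iff _).1 hs
  have hAx : P.mulA z.1 = P.b := hx.1.1
  have hqc := P.inner_q_c hf.mulA_c
  have h3 := inner_nonneg_of_mem_orthant hw h2.1.2
  have h4 := h2.2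
  rw [slack, inner_sub_right, inner_mulAT_right, hf.mulA_q, hqc] at h4
  rw [slack, inner_sub_right] at h3
  have h5 := h1.2
  rw [gap, lagrangian, lagrangian, P.inner_mulAT_right z.1, hAx]
  rw [real_inner_comm] at h3
  linarith

/-- Every pair has a pair of optimal solutions within the weighted sum of its distances to the two
optimal sets. -/
theorem IsScaling.exists_optimal_normM_le {τ σ α γ f : ℝ} (h : P.IsScaling τ σ α γ)
    (hf : P.HasOptimalValue f) (z : PrimalDual m n) :
    ∃ w : PrimalDual m n, w.1 ∈ P.Xopt ∧ P.slack w.2 ∈ P.Sopt ∧ P.normM τ σ (z - w) ≤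
      α * Metric.infDist z.1 P.Xopt + γ * Metric.infDist (P.slack z.2) P.Sopt := by
  obtain ⟨x, hx, hxd⟩ := hf.primal.isClosed.exists_infDist_eq_dist hf.primal.nonempty z.1
  obtain ⟨s, hs, hsd⟩ := hf.dual.isClosed.exists_infDist_eq_dist hf.dual.nonempty (P.slack z.2)
  have hmem : s - P.slack z.2 ∈ P.kerAᗮ :=
    sub_mem_of_mem_affineSet (hf.dual.subset hs).1 (P.Vd_eq ▸ P.slack_mem_Vd z.2)
  obtain ⟨y, hy⟩ := P.mem_orthogonal_kerA.1 hmem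
  -- the part of `y` in the range of `A` has the same image under `Aᵀ`
  set R := LinearMap.range (Matrix.toEuclideanLin P.A) with hR
  obtain ⟨u, hu⟩ : ∃ u, P.mulA u = R.starProjection y := by
    have := Submodule.starProjection_apply_mem R y
    exact LinearMap.mem_range.1 this
  have hAT : P.mulAT (P.mulA u) = s - P.slack z.2 := by
    rw [← hy, hu, ← sub_eq_zero, ← neg_eq_zero, neg_sub, ← mulAT_sub]
    refine ext_inner_left ℝ fun v => ?_
    rw [inner_mulAT_right, inner_zero_right]
    exact Submodule.sub_starProjection_mem_orthogonal y _ (LinearMap.mem_range_self _ v)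
  refine ⟨(x, z.2 - P.mulA u), hx, ?_, ?_⟩
  · have : P.slack (z.2 - P.mulA u) = s := by
      rw [slack, mulAT_sub, hAT, slack]; abel
    simpa only [this] using hs
  · refine (h.normM_le _).trans ?_
    have ht := Real.sqrt_pos.2 h.tau_pos
    have hsq := Real.sqrt_pos.2 h.sigma_pos
    have h1 : α = 1 / √τ := eq_one_div_of_mul_eq_one_left h.alpha_mul
    have h2 := P.lamMin_mul_norm_mulA_le u
    rw [hAT, ← dist_eq_norm, dist_comm, ← hsd] at h2
    have h3 : ‖P.mulA u‖ / √σ ≤ γ * Metric.infDist (P.slack z.2) P.Sopt := by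
      rw [div_le_iff₀ hsq]
      refine le_of_mul_le_mul_left ?_ h.lamMin_pos
      refine h2.trans_eq ?_
      linear_combination (-Metric.infDist (P.slack z.2) P.Sopt) * h.gamma_mul
    have e : (z - (x, z.2 - P.mulA u)).2 = P.mulA u := by simp
    rw [e, Prod.fst_sub, ← dist_eq_norm, ← hxd, h1, div_eq_mul_one_div, mul_comm (1 / √τ)]
    linarith

/-- The normalized gap at `z` in radius `r` is at most `g`. -/
def GapBound (P : LPData m n) (τ σ r g : ℝ) (z : PrimalDual m n) : Prop :=
  ∀ w : PrimalDual m n, w.1 ∈ orthant n → P.normM τ σ (w - z) ≤ r → P.gap z w ≤ r * g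

namespace GapBound

variable {τ σ r g : ℝ} {z : PrimalDual m n}

theorem nonneg (hg : P.GapBound τ σ r g z) (hr : 0 < r) (hz : z.1 ∈ orthant n) : 0 ≤ g := by
  have h := hg z hz (by rw [sub_self, normM_zero]; exact hr.le)
  rw [gap, sub_self] at h
  exact nonneg_of_mul_nonneg_right h hr

theorem primal_infeasibility_le (hg : P.GapBound τ σ r g z) (h : P.IsStepSize τ σ) (hr : 0 < r)
    (hz : z.1 ∈ orthant n) : ‖P.mulA z.1 - P.b‖ * √σ ≤ g := by
  have hs := Real.sqrt_pos.2 h.sigma_pos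
  set v := P.mulA z.1 - P.b with hv
  rcases (norm_nonneg v).eq_or_lt with h0 | h0
  · rw [← h0, zero_mul]
    exact hg.nonneg hr hz
  set t := r * √σ / ‖v‖ with ht
  have ht0 : 0 ≤ t := by positivity
  have h1 := hg (z.1, z.2 - t • v) hz (by
    refine (h.normM_le _).trans_eq ?_
    simp only [Prod.fst_sub, Prod.snd_sub, sub_self, sub_sub_cancel_left, norm_zero, norm_neg,
      norm_smul, Real.norm_eq_abs, abs_of_nonneg ht0]
    rw [ht]
    field_simp
    ring)
  have h2 : P.gap z (z.1, z.2 - t • v) = t * ‖v‖ ^ 2 := by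
    have : ‖v‖ ^ 2 = inner ℝ (P.mulA z.1) v - inner ℝ P.b v := by
      rw [← inner_sub_left, ← hv, real_inner_self_eq_norm_sq]
    rw [this]
    simp only [gap, lagrangian, inner_mulAT_right, inner_sub_right, real_inner_smul_right]
    ring
  rw [h2] at h1
  have h3 : t * ‖v‖ ^ 2 = r * (‖v‖ * √σ) := by rw [ht]; field_simp
  rw [h3] at h1
  exact le_of_mul_le_mul_left h1 hr

theorem dual_infeasibility_le (hg : P.GapBound τ σ r g z) (h : P.IsStepSize τ σ) (hr : 0 < r)
    (hz : z.1 ∈ orthant n) : ‖negPart (P.slack z.2)‖ * √τ ≤ g := by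
  have hs := Real.sqrt_pos.2 h.tau_pos
  set v := negPart (P.slack z.2) with hv
  rcases (norm_nonneg v).eq_or_lt with h0 | h0
  · rw [← h0, zero_mul]
    exact hg.nonneg hr hz
  set t := r * √τ / ‖v‖ with ht
  have ht0 : 0 ≤ t := by positivity
  have h1 := hg (z.1 + t • v, z.2)
    (add_mem_orthant hz (smul_mem_orthant ht0 (negPart_mem_orthant _))) (by
    refine (h.normM_le _).trans_eq ?_
    simp only [Prod.fst_sub, Prod.snd_sub, sub_self, add_sub_cancel_left, norm_zero,
      norm_smul, Real.norm_eq_abs, abs_of_nonneg ht0]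
    rw [ht]
    field_simp
    ring)
  have h2 : P.gap z (z.1 + t • v, z.2) = t * ‖v‖ ^ 2 := by
    have : ‖v‖ ^ 2 = inner ℝ v (P.mulAT z.2) - inner ℝ P.c v := by
      have := inner_negPart_self (P.slack z.2)
      rw [← hv, slack, inner_sub_left, real_inner_comm v (P.mulAT z.2)] at this
      linarith
    rw [this]
    simp only [gap, lagrangian, inner_add_right, inner_add_left, real_inner_smul_right,
      real_inner_smul_left]
    ring
  rw [h2] at h1
  have h3 : t * ‖v‖ ^ 2 = r * (‖v‖ * √τ) := by rw [ht]; field_simp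
  rw [h3] at h1
  exact le_of_mul_le_mul_left h1 hr

theorem objective_gap_le (hg : P.GapBound τ σ r g z) (h : P.IsStepSize τ σ) (hr : 0 < r)
    (hz : z.1 ∈ orthant n) {R : ℝ} (hrR : r ≤ R) (hzR : P.normM τ σ z ≤ R) :
    inner ℝ P.c z.1 - inner ℝ P.b z.2 ≤ R * g := by
  have hR : 0 < R := hr.trans_le hrR
  set t := r / R with ht
  have ht0 : 0 < t := by positivity
  have ht1 : t ≤ 1 := (div_le_one hR).2 hrR
  have h1 := hg ((1 - t) • z) (smul_mem_orthant (by linarith) hz) (by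
    have e : (1 - t) • z - z = -(t • z) := by rw [sub_smul, one_smul]; abel
    rw [e, normM_neg, h.normM_smul ht0.le, ht, div_mul_eq_mul_div, div_le_iff₀ hR]
    gcongr)
  have h2 : P.gap z ((1 - t) • z) = t * (inner ℝ P.c z.1 - inner ℝ P.b z.2) := by
    simp only [gap, lagrangian, Prod.smul_fst, Prod.smul_snd, mulAT_smul, real_inner_smul_right,
      real_inner_smul_left]
    ring
  rw [h2, ht, div_mul_eq_mul_div, div_le_iff₀ hR] at h1
  refine le_of_mul_le_mul_left ?_ hr
  linarith

end GapBound

theorem HasOptimalValue.norm_c_pos {f : ℝ} (hf : P.HasOptimalValue f) : 0 < ‖P.c‖ :=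
  norm_pos_iff.2 hf.primal.g_ne_zero

theorem HasOptimalValue.norm_q_pos {f : ℝ} (hf : P.HasOptimalValue f) : 0 < ‖P.q‖ :=
  norm_pos_iff.2 hf.dual.g_ne_zero

theorem HasOptimalValue.one_le_thetaP {f : ℝ} (hf : P.HasOptimalValue f) : 1 ≤ P.thetaP := by
  rw [thetaP, P.Vp_eq hf.mulA_q]
  exact (limitingER_spec hf.primal.nonempty hf.primal.subset).1

theorem HasOptimalValue.one_le_thetaD {f : ℝ} (hf : P.HasOptimalValue f) : 1 ≤ P.thetaD := by
  rw [thetaD, P.Vd_eq]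
  exact (limitingER_spec hf.dual.nonempty hf.dual.subset).1

theorem HasOptimalValue.muP_pos {f : ℝ} (hf : P.HasOptimalValue f) : 0 < P.muP := by
  rw [muP, P.Vp_eq hf.mulA_q]
  exact hf.primal.lpSharpness_pos

theorem HasOptimalValue.muD_pos {f : ℝ} (hf : P.HasOptimalValue f) : 0 < P.muD := by
  rw [muD, P.Vd_eq]
  exact hf.dual.lpSharpness_pos

theorem HasOptimalValue.muP_le_one {f : ℝ} (hf : P.HasOptimalValue f) : P.muP ≤ 1 := by
  rw [muP, P.Vp_eq hf.mulA_q]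
  exact hf.primal.lpSharpness_le_one

theorem HasOptimalValue.muD_le_one {f : ℝ} (hf : P.HasOptimalValue f) : P.muD ≤ 1 := by
  rw [muD, P.Vd_eq]
  exact hf.dual.lpSharpness_le_one

/-- The correction that makes `x` satisfy `A x = b`. -/
theorem HasOptimalValue.exists_correction {f : ℝ} (hf : P.HasOptimalValue f)
    (x : EuclideanSpace ℝ (Fin n)) :
    ∃ u ∈ P.kerAᗮ, x - u ∈ P.Vp ∧ P.lamMin * ‖u‖ ≤ ‖P.mulA x - P.b‖ := by
  refine ⟨P.kerAᗮ.starProjection (x - P.q), Submodule.starProjection_apply_mem _ _, ?_, ?_⟩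
  · rw [P.Vp_eq hf.mulA_q]
    have h := Submodule.sub_starProjection_mem_orthogonal (K := P.kerAᗮ) (x - P.q)
    rw [Submodule.orthogonal_orthogonal] at h
    rw [sub_right_comm] at h
    exact h
  · have h1 := P.lamMin_mul_norm_le (Submodule.starProjection_apply_mem P.kerAᗮ (x - P.q))
    have h := Submodule.sub_starProjection_mem_orthogonal (K := P.kerAᗮ) (x - P.q)
    rw [Submodule.orthogonal_orthogonal, mem_kerA, mulA_sub, sub_eq_zero, mulA_sub, hf.mulA_q] at h
    rwa [h]

/-- The primal error bound at a nonnegative point, which need not satisfy `A x = b`. As `A c = 0`,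
the correction `u` leaves the objective unchanged. -/
theorem HasOptimalValue.infDist_Xopt_le {f : ℝ} (hf : P.HasOptimalValue f)
    {x u : EuclideanSpace ℝ (Fin n)} (hx : x ∈ orthant n) (hu : u ∈ P.kerAᗮ) (hxu : x - u ∈ P.Vp) :
    Metric.infDist x P.Xopt ≤ 1 / P.muP *
      (3 * P.thetaP * ‖u‖ + max (inner ℝ P.c x - f) 0 / ‖P.c‖) := by
  have hV := P.Vp_eq hf.mulA_q
  have h1 := hf.primal.infDist_le (hV ▸ hxu)
  rw [← hV] at h1
  change _ ≤ 1 / P.muP * (2 * P.thetaP * _ + _) at h1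
  have hd : dist x (x - u) = ‖u‖ := by rw [dist_eq_norm, sub_sub_cancel]
  have h2 : Metric.infDist x P.Xopt ≤ Metric.infDist (x - u) P.Xopt + dist x (x - u) :=
    Metric.infDist_le_infDist_add_dist
  have h3 : Metric.infDist (x - u) (orthant n) ≤ ‖u‖ := by
    rw [← hd, dist_comm]
    exact Metric.infDist_le_dist_of_mem hx
  have h4 : inner ℝ P.c (x - u) = inner ℝ P.c x := by
    rw [inner_sub_right, hu _ (P.mem_kerA.2 hf.mulA_c), sub_zero]
  rw [h4] at h1
  rw [hd] at h2
  have hθ := hf.one_le_thetaP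
  have hμ := hf.muP_pos
  have h5 : ‖u‖ ≤ 1 / P.muP * (P.thetaP * ‖u‖) := by
    have : 1 ≤ 1 / P.muP := (one_le_div hμ).2 hf.muP_le_one
    calc ‖u‖ = 1 * (1 * ‖u‖) := by ring
      _ ≤ _ := by gcongr
  have h6 : 1 / P.muP * (2 * P.thetaP * Metric.infDist (x - u) (orthant n) +
      max (inner ℝ P.c x - f) 0 / ‖P.c‖) ≤ 1 / P.muP * (2 * P.thetaP * ‖u‖ +
      max (inner ℝ P.c x - f) 0 / ‖P.c‖) := by gcongr
  calc _ ≤ 1 / P.muP * (2 * P.thetaP * ‖u‖ + max (inner ℝ P.c x - f) 0 / ‖P.c‖) +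
        1 / P.muP * (P.thetaP * ‖u‖) := by linarith
    _ = _ := by ring

theorem HasOptimalValue.inner_q_slack {f : ℝ} (hf : P.HasOptimalValue f)
    (y : EuclideanSpace ℝ (Fin m)) : inner ℝ P.q (P.slack y) = -inner ℝ P.b y := by
  have hqc := P.inner_q_c hf.mulA_c
  rw [slack, inner_sub_right, inner_mulAT_right, hf.mulA_q, hqc, zero_sub]

theorem HasOptimalValue.infDist_Sopt_le {f : ℝ} (hf : P.HasOptimalValue f)
    (y : EuclideanSpace ℝ (Fin m)) :
    Metric.infDist (P.slack y) P.Sopt ≤ 1 / P.muD *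
      (2 * P.thetaD * ‖negPart (P.slack y)‖ + max (f - inner ℝ P.b y) 0 / ‖P.q‖) := by
  have hV := P.Vd_eq
  have h1 := hf.dual.infDist_le (hV ▸ P.slack_mem_Vd y)
  rw [← hV, hf.inner_q_slack, ← norm_negPart_eq_infDist] at h1
  have e : -inner ℝ P.b y - -f = f - inner ℝ P.b y := by ring
  rw [e] at h1
  exact h1

/-- An infeasible dual point can exceed the optimal value only in proportion to its infeasibility:
pair its slack with the primal optimal solution of least norm. -/
theorem HasOptimalValue.dual_objective_le {f : ℝ} (hf : P.HasOptimalValue f)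
    (y : EuclideanSpace ℝ (Fin m)) :
    inner ℝ P.b y - f ≤ Metric.infDist 0 P.Xopt * ‖negPart (P.slack y)‖ := by
  obtain ⟨x, hx, hxd⟩ := hf.primal.isClosed.exists_infDist_eq_dist hf.primal.nonempty 0
  rw [dist_zero_left] at hxd
  have h1 := neg_inner_le_norm_negPart hx.1.2 (P.slack y)
  have hAx : P.mulA x = P.b := hx.1.1
  have h2 := ((hf.primal.mem_iff x).1 hx).2
  rw [hxd]
  refine le_trans (le_of_eq ?_) h1
  rw [slack, inner_sub_right, inner_mulAT_right, hAx, real_inner_comm P.c x, h2]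
  ring

/-- The primal counterpart of `dual_objective_le`, with the correction `u` as the infeasibility. -/
theorem HasOptimalValue.le_primal_objective {f : ℝ} (hf : P.HasOptimalValue f)
    {x u : EuclideanSpace ℝ (Fin n)} (hx : x ∈ orthant n) (hxu : x - u ∈ P.Vp) :
    f - inner ℝ P.c x ≤ Metric.infDist P.c P.Sopt * ‖u‖ := by
  obtain ⟨s, hs, hsd⟩ := hf.dual.isClosed.exists_infDist_eq_dist hf.dual.nonempty P.c
  rw [dist_eq_norm] at hsd
  have hs' := (hf.dual.mem_iff s).1 hs
  rw [P.Vp_eq hf.mulA_q] at hxu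
  have h1 : inner ℝ (x - u - P.q) (s - P.c) = 0 := hs'.1.1 _ hxu
  have h2 := inner_nonneg_of_mem_orthant hx hs'.1.2
  have hqc := P.inner_q_c hf.mulA_c
  have h3 := real_inner_le_norm (P.c - s) (-u)
  rw [norm_neg, ← hsd] at h3
  refine le_trans (le_of_eq ?_ |>.trans (sub_le_self _ h2)) h3
  simp only [inner_sub_left, inner_sub_right, inner_neg_right, hqc, hs'.2] at h1 ⊢
  rw [real_inner_comm P.c x, real_inner_comm P.c u, real_inner_comm s u] at *
  linarith

/-- The constant of the linear growth of the normalized duality gap around the optimal pairs; it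
equals `6 / 8.5` times the constant `N` of the iteration bound. -/
noncomputable def growthConst (P : LPData m n) : ℝ :=
  6 * P.kappa * (1 / P.muP + 1 / P.muD) *
    (P.thetaP + P.thetaD + Metric.infDist 0 P.Xopt / ‖P.q‖ + Metric.infDist P.c P.Sopt / ‖P.c‖)

/-- The weighted distance of `z` to the optimal pairs. -/
noncomputable def weightedDist (P : LPData m n) (α γ : ℝ) (z : PrimalDual m n) : ℝ :=
  α * Metric.infDist z.1 P.Xopt + γ * Metric.infDist (P.slack z.2) P.Sopt

/-- The normalized duality gap grows linearly with the distance to the optimal pairs. The gap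
bounds the two infeasibilities and the two objective errors, and these bound the distances through
the global error bounds of the primal and of the dual. -/
theorem IsScaling.weightedDist_le {τ σ α γ f r g : ℝ} {z : PrimalDual m n}
    (h : P.IsScaling τ σ α γ) (hf : P.HasOptimalValue f) (hg : P.GapBound τ σ r g z) (hr : 0 < r)
    (hz : z.1 ∈ orthant n) (hrD : r ≤ 2 * P.weightedDist α γ 0)
    (hzD : P.normM τ σ z ≤ 2 * P.weightedDist α γ 0) :
    P.weightedDist α γ z ≤ P.growthConst * g := by
  have hs := Real.sqrt_pos.2 h.sigma_pos
  have hα := h.alpha_pos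
  have hγ := h.gamma_pos
  have hnc := hf.norm_c_pos
  have hnq := hf.norm_q_pos
  have hμp := hf.muP_pos
  have hμd := hf.muD_pos
  have hθp := hf.one_le_thetaP
  have hθd := hf.one_le_thetaD
  have hg0 := hg.nonneg hr hz
  obtain ⟨u, hu, hxu, hun⟩ := hf.exists_correction z.1
  have h1 := hg.primal_infeasibility_le h.toIsStepSize hr hz
  have h2 := hg.dual_infeasibility_le h.toIsStepSize hr hz
  have h3 := hg.objective_gap_le h.toIsStepSize hr hz hrD hzD
  have hu' : ‖u‖ ≤ γ * g := by
    calc ‖u‖ = γ * (P.lamMin * √σ) * ‖u‖ := by rw [h.gamma_mul, one_mul]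
      _ = γ * (P.lamMin * ‖u‖ * √σ) := by ring
      _ ≤ γ * (‖P.mulA z.1 - P.b‖ * √σ) := by gcongr
      _ ≤ _ := by gcongr
  have hs' : ‖negPart (P.slack z.2)‖ ≤ α * g := by
    calc ‖negPart (P.slack z.2)‖ = α * √τ * ‖negPart (P.slack z.2)‖ := by rw [h.alpha_mul, one_mul]
      _ = α * (‖negPart (P.slack z.2)‖ * √τ) := by ring
      _ ≤ _ := by gcongr
  have h4 := hf.infDist_Xopt_le hz hu hxu
  have h5 := hf.infDist_Sopt_le z.2
  have h6 := hf.dual_objective_le z.2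
  have h7 := hf.le_primal_objective hz hxu
  have hD : P.weightedDist α γ 0 =
      α * Metric.infDist 0 P.Xopt + γ * Metric.infDist P.c P.Sopt := by
    rw [weightedDist, Prod.fst_zero, Prod.snd_zero, slack, mulAT_zero, sub_zero]
  rw [weightedDist, growthConst]
  set Rp := Metric.infDist 0 P.Xopt
  set Rd := Metric.infDist P.c P.Sopt
  have hRp : 0 ≤ Rp := Metric.infDist_nonneg
  have hRd : 0 ≤ Rd := Metric.infDist_nonneg
  rw [hD] at h3
  have h8 : max (inner ℝ P.c z.1 - f) 0 ≤ (2 * (α * Rp + γ * Rd) + α * Rp) * g := by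
    refine max_le ?_ (by positivity)
    have : Rp * ‖negPart (P.slack z.2)‖ ≤ Rp * (α * g) := by gcongr
    linarith
  have h9 : max (f - inner ℝ P.b z.2) 0 ≤ (2 * (α * Rp + γ * Rd) + γ * Rd) * g := by
    refine max_le ?_ (by positivity)
    have : Rd * ‖u‖ ≤ Rd * (γ * g) := by gcongr
    linarith
  have hk1 : α / ‖P.c‖ * γ = α * γ * (1 / ‖P.c‖) := by ring
  have hk2 : α / ‖P.c‖ * α = α * γ * (1 / ‖P.q‖) := by
    field_simp
    linarith [h.balance]
  have hk3 : γ / ‖P.q‖ = α / ‖P.c‖ := by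
    rw [div_eq_div_iff hnq.ne' hnc.ne']
    exact h.balance
  have hx : α * Metric.infDist z.1 P.Xopt ≤ 1 / P.muP * (3 * (α * γ) *
      (P.thetaP + P.thetaD + Rp / ‖P.q‖ + Rd / ‖P.c‖)) * g := by
    calc α * Metric.infDist z.1 P.Xopt
        ≤ α * (1 / P.muP * (3 * P.thetaP * (γ * g) +
          (2 * (α * Rp + γ * Rd) + α * Rp) * g / ‖P.c‖)) := by
          gcongr
          exact h4.trans (by gcongr)
      _ = 1 / P.muP * (3 * P.thetaP * (α * γ) + 3 * (α / ‖P.c‖ * α) * Rp +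
          2 * (α / ‖P.c‖ * γ) * Rd) * g := by ring
      _ = 1 / P.muP * ((α * γ) * (3 * P.thetaP + 3 * (Rp / ‖P.q‖) + 2 * (Rd / ‖P.c‖))) * g := by
          rw [hk1, hk2]; ring
      _ ≤ 1 / P.muP * ((α * γ) *
          (3 * (P.thetaP + P.thetaD + Rp / ‖P.q‖ + Rd / ‖P.c‖))) * g := by
          gcongr
          have : 0 ≤ Rd / ‖P.c‖ := by positivity
          linarith
      _ = _ := by ring
  have hy : γ * Metric.infDist (P.slack z.2) P.Sopt ≤ 1 / P.muD * (3 * (α * γ) *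
      (P.thetaP + P.thetaD + Rp / ‖P.q‖ + Rd / ‖P.c‖)) * g := by
    calc γ * Metric.infDist (P.slack z.2) P.Sopt
        ≤ γ * (1 / P.muD * (2 * P.thetaD * (α * g) +
          (2 * (α * Rp + γ * Rd) + γ * Rd) * g / ‖P.q‖)) := by
          gcongr
          exact h5.trans (by gcongr)
      _ = 1 / P.muD * (2 * P.thetaD * (α * γ) + 2 * (γ / ‖P.q‖ * α) * Rp +
          3 * (γ / ‖P.q‖ * γ) * Rd) * g := by ring
      _ = 1 / P.muD * ((α * γ) * (2 * P.thetaD + 2 * (Rp / ‖P.q‖) + 3 * (Rd / ‖P.c‖))) * g := by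
          rw [hk3, hk1, hk2]; ring
      _ ≤ 1 / P.muD * ((α * γ) *
          (3 * (P.thetaP + P.thetaD + Rp / ‖P.q‖ + Rd / ‖P.c‖))) * g := by
          gcongr
          have : 0 ≤ Rp / ‖P.q‖ := by positivity
          linarith
      _ = _ := by ring
  refine (add_le_add hx hy).trans_eq ?_
  rw [h.mul_eq]
  ring

/-! ### The restart scheme -/

theorem rPDHG_add (τ σ β : ℝ) (z₀ : PrimalDual m n) (T k : ℕ) :
    P.rPDHG τ σ β z₀ (T + k) = (P.rStep τ σ β)^[k] (P.rPDHG τ σ β z₀ T) := by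
  rw [rPDHG, rPDHG, add_comm, Function.iterate_add_apply]

/-- The state of rPDHG at the beginning of outer loop `N`. -/
def freshState (N : ℕ) (prev start : PrimalDual m n) : RState m n where
  outer := N
  inner := 0
  prevStart := prev
  start := start
  cur := start
  total := 0

/-- As long as the restart condition fails, the state records the PDHG iterates and their sum. -/
theorem iterate_rStep_of_not_restartCond (τ σ β : ℝ) (N : ℕ) (prev start : PrimalDual m n) (j : ℕ)
    (hj : ∀ k, 1 ≤ k → k ≤ j → ¬P.restartCond τ σ β N k prev start (P.pdhgAvg τ σ start k)) :
    (P.rStep τ σ β)^[j] (freshState N prev start) =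
      { outer := N, inner := j, prevStart := prev, start := start,
        cur := (P.pdhgStep τ σ)^[j] start, total := P.pdhgSum τ σ start j } := by
  induction j with
  | zero => rfl
  | succ j ih =>
    rw [Function.iterate_succ_apply', ih fun k h1 h2 => hj k h1 (h2.trans j.le_succ)]
    have h := hj (j + 1) (Nat.le_add_left 1 j) le_rfl
    rw [pdhgAvg, pdhgSum_succ, Function.iterate_succ_apply'] at h
    simp only [rStep, ← Function.iterate_succ_apply' (P.pdhgStep τ σ), Nat.succ_eq_add_one,
      ← pdhgSum_succ]
    exact if_neg h

/-- If the restart condition holds at `K`, then outer loop `N` ends after at most `K` steps, with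
an average of its iterates at which the restart condition holds. -/
theorem exists_restart {τ σ β : ℝ} {N : ℕ} {prev start : PrimalDual m n} {K : ℕ} (hK : 1 ≤ K)
    (h : P.restartCond τ σ β N K prev start (P.pdhgAvg τ σ start K)) :
    ∃ k, 1 ≤ k ∧ k ≤ K ∧ P.restartCond τ σ β N k prev start (P.pdhgAvg τ σ start k) ∧
      (P.rStep τ σ β)^[k] (freshState N prev start) =
        freshState (N + 1) start (P.pdhgAvg τ σ start k) := by
  classical
  have hex : ∃ k, 1 ≤ k ∧ P.restartCond τ σ β N k prev start (P.pdhgAvg τ σ start k) := ⟨K, hK, h⟩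
  obtain ⟨hk1, hk⟩ := Nat.find_spec hex
  have hmin := fun j => @Nat.find_min _ _ hex j
  have hkK : Nat.find hex ≤ K := Nat.find_min' hex ⟨hK, h⟩
  set k := Nat.find hex
  refine ⟨k, hk1, hkK, hk, ?_⟩
  obtain ⟨j, hj⟩ := Nat.exists_eq_add_of_le' hk1
  rw [hj] at hk ⊢
  rw [Function.iterate_succ_apply', iterate_rStep_of_not_restartCond _ _ _ _ _ _ _
    fun i h1 h2 hi => hmin i (by omega) ⟨h1, hi⟩]
  simp only [rStep, ← Function.iterate_succ_apply' (P.pdhgStep τ σ), Nat.succ_eq_add_one,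
    ← pdhgSum_succ]
  exact if_pos hk

/-- The facts about a restart point `start` and its predecessor `prev` that drive the analysis:
`start` is an average of PDHG iterates from `prev`, up to its `1 / k` gap estimate, and neither
point is farther from a saddle point than the origin. -/
structure IsRestartPoint (P : LPData m n) (τ σ : ℝ) (prev start : PrimalDual m n) : Prop where
  mem_orthant : start.1 ∈ orthant n
  exists_gap_le : ∃ k : ℕ, 1 ≤ k ∧ ∀ w : PrimalDual m n, w.1 ∈ orthant n →
    P.gap start w ≤ P.normM τ σ (w - prev) ^ 2 / (2 * k)
  prev_le : ∀ w : PrimalDual m n, w.1 ∈ orthant n → P.IsSaddle w →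
    P.normM τ σ (prev - w) ≤ P.normM τ σ w
  start_le : ∀ w : PrimalDual m n, w.1 ∈ orthant n → P.IsSaddle w →
    P.normM τ σ (start - w) ≤ P.normM τ σ (prev - w)

theorem isRestartPoint_pdhgAvg {τ σ : ℝ} (h : P.IsStepSize τ σ) {z : PrimalDual m n}
    (hz : ∀ w : PrimalDual m n, w.1 ∈ orthant n → P.IsSaddle w →
      P.normM τ σ (z - w) ≤ P.normM τ σ w) {k : ℕ} (hk : 1 ≤ k) :
    P.IsRestartPoint τ σ z (P.pdhgAvg τ σ z k) where
  mem_orthant := P.pdhgAvg_mem_orthant τ σ z k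
  exists_gap_le := ⟨k, hk, fun w hw => h.gap_pdhgAvg_le z w hw hk⟩
  prev_le := hz
  start_le _ hw hs := h.normM_pdhgAvg_sub_le hw hs z hk

theorem HasOptimalValue.weightedDist_zero_pos {τ σ α γ f : ℝ} (hf : P.HasOptimalValue f)
    (h : P.IsScaling τ σ α γ) : 0 < P.weightedDist α γ 0 := by
  have h0 : 0 < Metric.infDist 0 P.Xopt := by
    refine (hf.primal.isClosed.notMem_iff_infDist_pos hf.primal.nonempty).1 fun h0 => ?_
    have h1 : P.mulA 0 = P.b := h0.1.1
    have h2 := (hf.primal.subset h0).1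
    change 0 - P.q ∈ P.kerA at h2
    have h3 := P.q_mem_orthogonal _ h2
    rw [zero_sub, inner_neg_left, neg_eq_zero, inner_self_eq_zero] at h3
    exact hf.dual.g_ne_zero h3
  rw [weightedDist]
  have := mul_pos h.alpha_pos h0
  have h2 : 0 ≤ γ * Metric.infDist (P.slack 0) P.Sopt :=
    mul_nonneg h.gamma_pos.le Metric.infDist_nonneg
  exact add_pos_of_pos_of_nonneg this h2

theorem IsScaling.exists_optimal_near_zero {τ σ α γ f : ℝ} (h : P.IsScaling τ σ α γ)
    (hf : P.HasOptimalValue f) : ∃ w : PrimalDual m n, w.1 ∈ orthant n ∧ P.IsSaddle w ∧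
      P.normM τ σ w ≤ P.weightedDist α γ 0 := by
  obtain ⟨w, h1, h2, h3⟩ := h.exists_optimal_normM_le hf 0
  rw [zero_sub, normM_neg] at h3
  exact ⟨w, h1.1.2, hf.isSaddle h1 h2, h3⟩

/-- Linear growth at a restart point, in terms of the quantity used in the restart condition. -/
theorem IsRestartPoint.weightedDist_le {τ σ α γ f : ℝ} {prev start : PrimalDual m n}
    (hp : P.IsRestartPoint τ σ prev start) (h : P.IsScaling τ σ α γ) (hf : P.HasOptimalValue f) :
    P.weightedDist α γ start ≤
      P.growthConst * P.normGap τ σ (P.normM τ σ (start - prev)) start := by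
  obtain ⟨w, hw, hws, hwD⟩ := h.exists_optimal_near_zero hf
  have hD := hf.weightedDist_zero_pos h
  set D := P.weightedDist α γ 0
  have h1 := hp.prev_le w hw hws
  have h2 := hp.start_le w hw hws
  have hz : P.normM τ σ start ≤ 2 * D := by
    have := h.normM_add_le (start - w) w
    rw [sub_add_cancel] at this
    linarith
  have hr : P.normM τ σ (start - prev) ≤ 2 * D := by
    have := h.normM_add_le (start - w) (w - prev)
    rw [sub_add_sub_cancel, P.normM_sub_comm τ σ w] at this
    linarith
  obtain ⟨k, hk, hgap⟩ := hp.exists_gap_le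
  have hk0 : (1 : ℝ) ≤ k := by exact_mod_cast hk
  rcases (P.normM_nonneg τ σ (start - prev)).eq_or_lt with h0 | h0
  · -- the restart point did not move: the gap is of second order and `start` is optimal
    rw [← h0, normGap, div_zero, zero_mul, mul_zero]
    refine le_of_forall_pos_le_add fun ε hε => ?_
    have hL : 0 < |P.growthConst| + 1 := by positivity
    set r := min (2 * D) (ε / (|P.growthConst| + 1)) with hrdef
    have hr0 : 0 < r := by positivity
    have hb : P.GapBound τ σ r r start := by
      intro v hv hvr
      refine (hgap v hv).trans ?_
      have h3 := h.normM_add_le (v - start) (start - prev)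
      rw [sub_add_sub_cancel, ← h0, add_zero] at h3
      have h4 : P.normM τ σ (v - prev) ^ 2 ≤ r ^ 2 :=
        pow_le_pow_left₀ (P.normM_nonneg τ σ _) (h3.trans hvr) 2
      rw [div_le_iff₀ (by positivity)]
      nlinarith [sq_nonneg r]
    have h5 := h.weightedDist_le hf hb hr0 hp.mem_orthant (min_le_left _ _) hz
    rw [zero_add]
    have h6 : r ≤ ε / (|P.growthConst| + 1) := min_le_right _ _
    rw [le_div_iff₀ hL] at h6
    nlinarith [le_abs_self P.growthConst]
  · exact h.weightedDist_le hf (fun v hv hvr => h.gap_le_mul_normGap hgap h0 v hv hvr) h0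
      hp.mem_orthant hr hz

/-- The average of `k` PDHG iterates has a normalized gap of order `1 / k`, relative to the distance
of the starting point to the optimal pairs. -/
theorem IsScaling.normGap_pdhgAvg_le {τ σ α γ f : ℝ} (h : P.IsScaling τ σ α γ)
    (hf : P.HasOptimalValue f) (z : PrimalDual m n) {k : ℕ} (hk : 1 ≤ k) :
    P.normGap τ σ (P.normM τ σ (P.pdhgAvg τ σ z k - z)) (P.pdhgAvg τ σ z k) ≤
      4 * P.weightedDist α γ z / k := by
  obtain ⟨w, h1, h2, h3⟩ := h.exists_optimal_normM_le hf z
  have h4 := h.normM_pdhgAvg_sub_le h1.1.2 (hf.isSaddle h1 h2) z hk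
  have h5 := h.normM_add_le (P.pdhgAvg τ σ z k - w) (w - z)
  rw [sub_add_sub_cancel, P.normM_sub_comm τ σ w] at h5
  refine (h.normGap_le fun v hv => h.gap_pdhgAvg_le z v hv hk).trans ?_
  change P.normM τ σ (z - w) ≤ P.weightedDist α γ z at h3
  exact div_le_div_of_nonneg_right (by linarith) (Nat.cast_nonneg k)

/-- One outer loop: it takes at most `K ≥ 4 L / β` steps, where `L` is the growth constant. -/
theorem IsRestartPoint.exists_next {τ σ α γ f β : ℝ} {prev start : PrimalDual m n}
    (hp : P.IsRestartPoint τ σ prev start) (h : P.IsScaling τ σ α γ) (hf : P.HasOptimalValue f)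
    {N K : ℕ} (hN : 1 ≤ N) (hK1 : 1 ≤ K) (hβ : 0 < β) (hK : 4 * P.growthConst / β ≤ K) :
    ∃ k ≤ K, ∃ next : PrimalDual m n, P.IsRestartPoint τ σ start next ∧
      P.normGap τ σ (P.normM τ σ (next - start)) next ≤
        β * P.normGap τ σ (P.normM τ σ (start - prev)) start ∧
      (P.rStep τ σ β)^[k] (freshState N prev start) = freshState (N + 1) start next := by
  have hcond : P.restartCond τ σ β N K prev start (P.pdhgAvg τ σ start K) := by
    refine Or.inr ⟨hN, ?_⟩
    refine (h.normGap_pdhgAvg_le hf start hK1).trans ?_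
    have hK0 : (0 : ℝ) < K := by exact_mod_cast hK1
    have h1 := hp.weightedDist_le h hf
    have h2 : 0 ≤ P.normGap τ σ (P.normM τ σ (start - prev)) start :=
      P.normGap_nonneg τ σ (P.normM_nonneg τ σ _) hp.mem_orthant
    rw [div_le_iff₀ hβ] at hK
    rw [div_le_iff₀ hK0]
    nlinarith [mul_le_mul_of_nonneg_right hK h2]
  obtain ⟨k, hk1, hkK, hk, hstep⟩ := exists_restart hK1 hcond
  refine ⟨k, hkK, _, isRestartPoint_pdhgAvg h.toIsStepSize (fun w hw hs =>
    (hp.start_le w hw hs).trans (hp.prev_le w hw hs)) hk1, ?_, hstep⟩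
  rcases hk with ⟨h0, -⟩ | ⟨-, hk⟩
  · omega
  · exact hk

/-- After the first outer loop, which consists of a single step, the normalized gap of the
restart points decreases geometrically with ratio `β`. -/
theorem IsScaling.exists_outer {τ σ α γ f β : ℝ} (h : P.IsScaling τ σ α γ)
    (hf : P.HasOptimalValue f) {K : ℕ} (hK1 : 1 ≤ K) (hβ : 0 < β)
    (hK : 4 * P.growthConst / β ≤ K) (j : ℕ) :
    ∃ T ≤ j * K + 1, ∃ prev start : PrimalDual m n, P.IsRestartPoint τ σ prev start ∧
      P.normGap τ σ (P.normM τ σ (start - prev)) start ≤ β ^ j * (4 * P.weightedDist α γ 0) ∧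
      P.rPDHG τ σ β 0 T = freshState (j + 1) prev start := by
  induction j with
  | zero =>
    have hcond : P.restartCond τ σ β 0 1 0 0 (P.pdhgAvg τ σ 0 1) := Or.inl ⟨rfl, rfl⟩
    obtain ⟨k, hk1, hkK, -, hstep⟩ := exists_restart le_rfl hcond
    refine ⟨k, by simpa using hkK, 0, _, isRestartPoint_pdhgAvg h.toIsStepSize (fun _ _ _ => ?_)
      hk1, ?_, hstep⟩
    · rw [zero_sub, normM_neg]
    · obtain rfl : k = 1 := le_antisymm hkK hk1
      simpa using h.normGap_pdhgAvg_le hf 0 le_rfl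
  | succ j ih =>
    obtain ⟨T, hT, prev, start, hp, hgap, hstate⟩ := ih
    obtain ⟨k, hkK, next, hnext, hdec, hstep⟩ :=
      hp.exists_next h hf (Nat.le_add_left 1 j) hK1 hβ hK
    refine ⟨T + k, ?_, start, next, hnext, ?_, ?_⟩
    · rw [add_mul, one_mul]
      omega
    · refine hdec.trans ?_
      rw [pow_succ', mul_assoc]
      gcongr
    · rw [rPDHG_add, hstate, hstep]

theorem HasOptimalValue.mulA_q_ne_zero {f : ℝ} (hf : P.HasOptimalValue f) : P.mulA P.q ≠ 0 :=
  fun h => hf.dual.g_ne_zero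
    (inner_self_eq_zero.1 (P.q_mem_orthogonal _ (P.mem_kerA.2 h) : inner ℝ P.q P.q = 0))

theorem HasOptimalValue.one_le_kappa {f : ℝ} (hf : P.HasOptimalValue f) : 1 ≤ P.kappa :=
  (one_le_div (P.lamMin_pos hf.mulA_q_ne_zero)).2 (P.lamMin_le_lamMax hf.mulA_q_ne_zero)

theorem HasOptimalValue.le_growthConst {f : ℝ} (hf : P.HasOptimalValue f) :
    24 ≤ P.growthConst := by
  have h1 := hf.one_le_kappa
  have h2 : 1 ≤ 1 / P.muP := (one_le_div hf.muP_pos).2 hf.muP_le_one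
  have h3 : 1 ≤ 1 / P.muD := (one_le_div hf.muD_pos).2 hf.muD_le_one
  have h4 := hf.one_le_thetaP
  have h5 := hf.one_le_thetaD
  have h6 : 0 ≤ Metric.infDist 0 P.Xopt / ‖P.q‖ :=
    div_nonneg Metric.infDist_nonneg (norm_nonneg _)
  have h7 : 0 ≤ Metric.infDist P.c P.Sopt / ‖P.c‖ :=
    div_nonneg Metric.infDist_nonneg (norm_nonneg _)
  calc (24 : ℝ) = 6 * 1 * (1 + 1) * (1 + 1 + 0 + 0) := by norm_num
    _ ≤ P.growthConst := by
      unfold growthConst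
      gcongr

theorem HasOptimalValue.infDist_zero_Vp {f : ℝ} (hf : P.HasOptimalValue f) :
    Metric.infDist 0 P.Vp = ‖P.q‖ := by
  rw [P.Vp_eq hf.mulA_q]
  exact infDist_zero_affineSet P.q_mem_orthogonal

theorem HasOptimalValue.infDist_zero_Vd {f : ℝ} (hf : P.HasOptimalValue f) :
    Metric.infDist 0 P.Vd = ‖P.c‖ := by
  rw [P.Vd_eq]
  refine infDist_zero_affineSet ?_
  rw [Submodule.orthogonal_orthogonal]
  exact P.mem_kerA.2 hf.mulA_c

/-- A decrease of the weighted distance by the factor `δ` decreases the distance to optima by the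
same factor, up to the ratio of the two weights. -/
theorem IsScaling.errDist_le {τ σ α γ f : ℝ} (h : P.IsScaling τ σ α γ) (hf : P.HasOptimalValue f)
    {z : PrimalDual m n} {δ : ℝ} (hδ : 0 ≤ δ)
    (hz : P.weightedDist α γ z ≤ δ * P.weightedDist α γ 0) :
    P.errDist z.1 (P.slack z.2) ≤ δ * (P.errDist 0 (P.slack 0) *
      ((1 + P.kappa * ‖P.c‖ / ‖P.q‖) * (1 + ‖P.q‖ / ‖P.c‖))) := by
  have hα := h.alpha_pos
  have hγ := h.gamma_pos
  have hnc := hf.norm_c_pos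
  have hnq := hf.norm_q_pos
  have hκ := hf.one_le_kappa
  have hr : γ / α = ‖P.q‖ / ‖P.c‖ := by
    rw [div_eq_div_iff hα.ne' hnc.ne', h.balance, mul_comm]
  have hr' : α / γ = ‖P.c‖ / ‖P.q‖ := by
    rw [div_eq_div_iff hγ.ne' hnq.ne', ← h.balance, mul_comm]
  set E := P.errDist 0 (P.slack 0) with hE
  have hE1 : Metric.infDist 0 P.Xopt ≤ E := le_max_left _ _
  have hE2 : Metric.infDist (P.slack 0) P.Sopt ≤ E := le_max_right _ _
  have hE0 : 0 ≤ E := Metric.infDist_nonneg.trans hE1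
  have hW : P.weightedDist α γ z ≤ δ * ((α + γ) * E) := by
    refine hz.trans (mul_le_mul_of_nonneg_left ?_ hδ)
    rw [weightedDist, Prod.fst_zero, Prod.snd_zero, add_mul]
    gcongr
  have h1 : 0 ≤ α * Metric.infDist z.1 P.Xopt := mul_nonneg hα.le Metric.infDist_nonneg
  have h2 : 0 ≤ γ * Metric.infDist (P.slack z.2) P.Sopt := mul_nonneg hγ.le Metric.infDist_nonneg
  rw [weightedDist] at hW
  set a := ‖P.c‖ / ‖P.q‖ with ha
  set b := ‖P.q‖ / ‖P.c‖ with hb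
  have ha0 : 0 < a := by positivity
  have hb0 : 0 < b := by positivity
  have hκa : a ≤ P.kappa * a := le_mul_of_one_le_left ha0.le hκ
  rw [mul_div_assoc, ← ha]
  refine max_le ?_ ?_
  · calc Metric.infDist z.1 P.Xopt ≤ δ * ((α + γ) * E) / α := by
          rw [le_div_iff₀ hα]
          linarith
      _ = δ * (E * (1 + γ / α)) := by field_simp
      _ = δ * (E * (1 * (1 + b))) := by rw [hr, one_mul]
      _ ≤ _ := by
        gcongr
        linarith
  · calc Metric.infDist (P.slack z.2) P.Sopt ≤ δ * ((α + γ) * E) / γ := by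
          rw [le_div_iff₀ hγ]
          linarith
      _ = δ * (E * (1 + α / γ)) := by field_simp; ring
      _ = δ * (E * ((1 + a) * 1)) := by rw [hr', mul_one]
      _ ≤ _ := by
        gcongr
        linarith

end LPData

theorem theorem3p1 {m n : ℕ} (P : LPData m n)
    (hc : P.mulA P.c = 0)
    (hopt : P.Xopt.Nonempty)
    (hprimal : (P.Fp \ P.Xopt).Nonempty)
    (hdual : (P.Fd \ P.Sopt).Nonempty)
    (τ σ : ℝ)
    (hτ : τ = ‖P.q‖ / (2 * P.kappa * ‖P.c‖))
    (hσ : σ = ‖P.c‖ / (2 * ‖P.q‖ * P.lamMax * P.lamMin))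
    (N E₀ : ℝ)
    (hN : N = 8.5 * P.kappa * (1 / P.muP + 1 / P.muD) *
      (P.thetaP + P.thetaD + Metric.infDist 0 P.Xopt / Metric.infDist 0 P.Vp +
        Metric.infDist P.c P.Sopt / Metric.infDist 0 P.Vd))
    (hE₀ : E₀ = P.errDist 0 (P.slack 0))
    (ε : ℝ) (hε : 0 < ε) (hεE₀ : ε ≤ E₀) :
    ∃ T : ℕ, IsLeast (P.hitTimes τ σ (1 / Real.exp 1) 0 ε) T ∧
      (T : ℝ) ≤ 5 * Real.exp 1 * N *
        Real.log (8 * Real.exp 1 * N * (E₀ / ε) *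
          (1 + P.kappa * ‖P.c‖ / ‖P.q‖) * (1 + ‖P.q‖ / ‖P.c‖)) + 1 := by
  obtain ⟨f, hq, hX, hS⟩ := P.exists_isArgmin hc hopt hprimal hdual
  have hf : P.HasOptimalValue f := ⟨hc, hq, hX, hS⟩
  obtain ⟨α, γ, h⟩ := LPData.exists_isScaling hf.mulA_q_ne_zero hX.g_ne_zero hτ hσ
  set e := Real.exp 1 with he
  have he1 : 1 ≤ e := Real.one_le_exp zero_le_one
  have hL := hf.le_growthConst
  set L := P.growthConst with hLdef
  have hNL : 6 * N = 8.5 * L := by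
    rw [hN, hLdef, LPData.growthConst, hf.infDist_zero_Vp, hf.infDist_zero_Vd]
    ring
  have hnc := hf.norm_c_pos
  have hnq := hf.norm_q_pos
  have hκ := hf.one_le_kappa
  set G := (1 + P.kappa * ‖P.c‖ / ‖P.q‖) * (1 + ‖P.q‖ / ‖P.c‖) with hG
  have hG1 : 1 ≤ G := one_le_mul_of_one_le_of_one_le
    (le_add_of_nonneg_right (by positivity)) (le_add_of_nonneg_right (by positivity))
  have hEε : 1 ≤ E₀ / ε := (one_le_div hε).2 hεE₀
  set X := 4 * L * (E₀ / ε) * G with hXdef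
  have hX1 : 1 ≤ X :=
    one_le_mul_of_one_le_of_one_le (one_le_mul_of_one_le_of_one_le (by linarith) hEε) hG1
  have hlog : 0 ≤ Real.log X := Real.log_nonneg hX1
  -- the length of an outer loop and the number of outer loops after the first one
  set K := ⌈4 * L / (1 / e)⌉₊ with hK
  set j := ⌈Real.log X⌉₊ with hj
  have hK1 : 1 ≤ K := Nat.one_le_ceil_iff.2 (by positivity)
  obtain ⟨T, hT, prev, start, hp, hgap, hstate⟩ :=
    h.exists_outer hf hK1 (by positivity : 0 < 1 / e) (Nat.le_ceil _) j
  have hdecay : X * (1 / e) ^ j ≤ 1 := by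
    have h1 : X ≤ e ^ j := by
      rw [he, ← Real.exp_nat_mul, mul_one, ← Real.log_le_iff_le_exp (by linarith)]
      exact Nat.le_ceil _
    rw [one_div_pow, mul_one_div]
    exact (div_le_one (by positivity)).2 h1
  have hhit : T ∈ P.hitTimes τ σ (1 / e) 0 ε := by
    change (P.rPDHG τ σ (1 / e) 0 T).inner = 0 ∧ P.errDist (P.rPDHG τ σ (1 / e) 0 T).start.1
      (P.slack (P.rPDHG τ σ (1 / e) 0 T).start.2) ≤ ε
    rw [hstate]
    refine ⟨rfl, ?_⟩
    have h1 : P.weightedDist α γ start ≤ (4 * L * (1 / e) ^ j) * P.weightedDist α γ 0 := by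
      refine (hp.weightedDist_le h hf).trans ?_
      calc L * _ ≤ L * ((1 / e) ^ j * (4 * P.weightedDist α γ 0)) := by gcongr
        _ = _ := by ring
    refine (h.errDist_le hf (by positivity) h1).trans ?_
    rw [← hE₀, ← hG]
    calc 4 * L * (1 / e) ^ j * (E₀ * G) = ε * (X * (1 / e) ^ j) := by
          rw [hXdef]; field_simp
      _ ≤ ε * 1 := by gcongr
      _ = ε := mul_one ε
  have hleast := Nat.sInf_mem ⟨T, hhit⟩
  refine ⟨sInf (P.hitTimes τ σ (1 / e) 0 ε), ⟨hleast, fun t ht => Nat.sInf_le ht⟩, ?_⟩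
  have hT' : ((sInf (P.hitTimes τ σ (1 / e) 0 ε) : ℕ) : ℝ) ≤ j * K + 1 := by
    exact_mod_cast (Nat.sInf_le hhit).trans hT
  refine hT'.trans (add_le_add_left ?_ 1)
  have hjle : (j : ℝ) ≤ Real.log X + 1 := (Nat.ceil_lt_add_one hlog).le
  have hKle : (K : ℝ) ≤ 5 * e * N := by
    have h1 : (K : ℝ) ≤ 4 * L / (1 / e) + 1 := (Nat.ceil_lt_add_one (by positivity)).le
    have h2 : 4 * L / (1 / e) = 4 * (e * L) := by rw [div_div_eq_mul_div, div_one]; ring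
    have h3 : 24 ≤ e * L := by nlinarith
    have h4 : 5 * e * N = 5 * 8.5 / 6 * (e * L) := by linear_combination 5 / 6 * e * hNL
    rw [h4]
    linarith
  have hlogle : Real.log X + 1 ≤ Real.log (8 * e * N * (E₀ / ε) *
      (1 + P.kappa * ‖P.c‖ / ‖P.q‖) * (1 + ‖P.q‖ / ‖P.c‖)) := by
    have hsum : Real.log X + 1 = Real.log (X * e) := by
      rw [Real.log_mul (zero_lt_one.trans_le hX1).ne' (by positivity), he, Real.log_exp]
    rw [hsum]
    refine Real.log_le_log (by positivity) ?_
    have h1 : 4 * L ≤ 8 * N := by linarith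
    calc X * e = 4 * L * (e * (E₀ / ε) * G) := by rw [hXdef]; ring
      _ ≤ 8 * N * (e * (E₀ / ε) * G) := by gcongr
      _ = _ := by rw [hG]; ring
  calc (j : ℝ) * K ≤ (Real.log X + 1) * (5 * e * N) := by gcongr
    _ = 5 * e * N * (Real.log X + 1) := mul_comm _ _
    _ ≤ _ := by
      gcongr
      have : 0 ≤ N := by linarith
      positivity
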